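/- Let $n\ge 1$ and let $\Lambda\subset\mathbb R^n$ be a lattice of full rank, that is, $\Lambda=\mathbb Z b_1+\dots+\mathbb Z b_n$ for a basis $b_1,\dots,b_n$ of $\mathbb R^n$. Equip the torus $\mathbb R^n/\Lambda$ with the flat Riemannian metric induced by the standard metric of $\mathbb R^n$. For real numbers $\alpha,\beta>0$ and $0\le p\le n$ let $$F_{\alpha\beta,p}^{\mathbb R^n/\Lambda}:=\alpha\, d\delta+\beta\,\delta d$$ act on the smooth (complex-valued) differential $p$-forms on $\mathbb R^n/\Lambda$, where $d$ is the exterior derivative and $\delta$ its formal $L^2$-adjoint. Its spectrum is the function $\mathbb C\to\mathbb N_0$ that assigns to $\lambda$ the dimension of the eigenspace $\{\omega: F_{\alpha\beta,p}^{\mathbb R^n/\Lambda}\,\omega=\lambda\omega\}$, and two such operators are called isospectral if their spectra are equal (eigenvalues with multiplicities). Let $1\le p\le n$, $\alpha,\alpha',\beta,\beta'>0$ and $c\in\mathbb R\setminus\{0\}$. Then: 1. If $p<n$ and $n\ne 2p$: $F_{\alpha\beta,p}^{\mathbb R^n/\Lambda}$ and $F_{\alpha'\beta',p}^{\mathbb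 R^n/c\Lambda}$ are isospectral if and only if $(\alpha',\beta')=(c^2\alpha,c^2\beta)$. 2. If $n=2p$: $F_{\alpha\beta,p}^{\mathbb R^n/\Lambda}$ and $F_{\alpha'\beta',p}^{\mathbb R^n/c\Lambda}$ are isospectral if and only if $\{\alpha',\beta'\}=\{c^2\alpha,c^2\beta\}$ (as sets). 3. If $p=n$ (where $\delta d=0$, so that the operators do not depend on $\beta$ and $\beta'$): $F_{\alpha\beta,n}^{\mathbb R^n/\Lambda}$ and $F_{\alpha'\beta',n}^{\mathbb R^n/c\Lambda}$ are isospectral if and only if $\alpha'=c^2\alpha$. -/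

import Mathlib

open scoped Pointwise

noncomputable section

open scoped ContDiff

namespace FlatTorus

variable {n : ℕ}

/-- Complex-valued alternating `p`-forms on the vector space `ℝⁿ`. -/
abbrev AltForm (n p : ℕ) : Type :=
  (EuclideanSpace ℝ (Fin n)) [⋀^Fin p]→L[ℝ] ℂ

/-- The flat torus `ℝⁿ / Λ`. -/
abbrev Torus (Λ : Submodule ℤ (EuclideanSpace ℝ (Fin n))) : Type :=
  EuclideanSpace ℝ (Fin n) ⧸ Λ

/-- The pull-back to `ℝⁿ` of a function on `ℝⁿ / Λ` along the canonical projection. -/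
def pullback (Λ : Submodule ℤ (EuclideanSpace ℝ (Fin n))) {X : Type} (θ : Torus Λ → X) :
    EuclideanSpace ℝ (Fin n) → X :=
  fun x => θ (Submodule.Quotient.mk x)

theorem pullback_add_mem (Λ : Submodule ℤ (EuclideanSpace ℝ (Fin n))) {X : Type}
    (θ : Torus Λ → X) {l : EuclideanSpace ℝ (Fin n)} (hl : l ∈ Λ) (x : EuclideanSpace ℝ (Fin n)) :
    pullback Λ θ (x + l) = pullback Λ θ x := by
  unfold pullback
  congr 1
  rw [Submodule.Quotient.eq]
  simpa using hl

/-- The function on `ℝⁿ / Λ` induced by a `Λ`-periodic function on `ℝⁿ`. -/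
def descend (Λ : Submodule ℤ (EuclideanSpace ℝ (Fin n))) {X : Type}
    (f : EuclideanSpace ℝ (Fin n) → X) (hf : ∀ l ∈ Λ, ∀ x, f (x + l) = f x) : Torus Λ → X :=
  Quotient.lift f (by
    intro a b hab
    have h : a - b ∈ Λ := (Submodule.quotientRel_def Λ).1 hab
    have := hf _ h b
    rwa [add_sub_cancel] at this)

theorem pullback_descend (Λ : Submodule ℤ (EuclideanSpace ℝ (Fin n))) {X : Type}
    (f : EuclideanSpace ℝ (Fin n) → X) (hf : ∀ l ∈ Λ, ∀ x, f (x + l) = f x) :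
    pullback Λ (descend Λ f hf) = f := rfl

theorem pullback_injective (Λ : Submodule ℤ (EuclideanSpace ℝ (Fin n))) {X : Type} :
    Function.Injective (pullback Λ (X := X)) := by
  intro θ η h
  funext q
  obtain ⟨x, rfl⟩ := Submodule.Quotient.mk_surjective Λ q
  exact congrFun h x

/-- The space `Ω^p(ℝⁿ / Λ, ℂ)` of smooth complex differential `p`-forms on the flat torus. The
projection `ℝⁿ → ℝⁿ / Λ` is a local isometry, and its differential identifies every tangent space
of the torus with `ℝⁿ`, isometrically and independently of the chosen point of the fibre. In this
trivialization a form is a map from the torus to the alternating forms on `ℝⁿ`. -/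
def smoothForms (Λ : Submodule ℤ (EuclideanSpace ℝ (Fin n))) (p : ℕ) :
    Submodule ℂ (Torus Λ → AltForm n p) where
  carrier := {θ | ContDiff ℝ ∞ (pullback Λ θ)}
  add_mem' := by
    intro a b ha hb
    rw [Set.mem_ofPred_eq] at ha hb ⊢
    exact ha.add hb
  zero_mem' := by
    rw [Set.mem_ofPred_eq]
    exact contDiff_const (c := (0 : AltForm n p))
  smul_mem' := by
    intro c θ h
    rw [Set.mem_ofPred_eq] at h ⊢
    exact h.const_smul c

theorem contDiff_pullback {Λ : Submodule ℤ (EuclideanSpace ℝ (Fin n))} {p : ℕ}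
    (θ : smoothForms Λ p) : ContDiff ℝ ∞ (pullback Λ θ.1) := θ.2

/-- Interior product with `v`, as a continuous linear map on alternating forms. -/
def interiorProd (p : ℕ) (v : EuclideanSpace ℝ (Fin n)) : AltForm n (p + 1) →L[ℝ] AltForm n p :=
  (ContinuousLinearMap.apply ℝ (AltForm n p) v).comp
    (ContinuousAlternatingMap.curryLeftLI (𝕜 := ℝ) (E := EuclideanSpace ℝ (Fin n)) (F := ℂ)
      (n := p)).toContinuousLinearMap

theorem interiorProd_apply (p : ℕ) (v : EuclideanSpace ℝ (Fin n)) (η : AltForm n (p + 1))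
    (w : Fin p → EuclideanSpace ℝ (Fin n)) :
    interiorProd p v η w = η (Matrix.vecCons v w) := rfl

/-- The codifferential `δ = - ∑ᵢ eᵢ ⌟ ∂ᵢ` of a form on `ℝⁿ`. -/
def euclCodiff (p : ℕ) (η : EuclideanSpace ℝ (Fin n) → AltForm n (p + 1)) :
    EuclideanSpace ℝ (Fin n) → AltForm n p :=
  fun x => - ∑ i, interiorProd p (EuclideanSpace.single i 1)
    (fderiv ℝ η x (EuclideanSpace.single i 1))

theorem fderiv_periodic {Λ : Submodule ℤ (EuclideanSpace ℝ (Fin n))} {p : ℕ}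
    {f : EuclideanSpace ℝ (Fin n) → AltForm n p} (hf : ∀ l ∈ Λ, ∀ x, f (x + l) = f x) :
    ∀ l ∈ Λ, ∀ x, fderiv ℝ f (x + l) = fderiv ℝ f x := by
  intro l hl x
  rw [← fderiv_comp_add_right]
  congr 1
  funext y
  exact hf l hl y

theorem contDiff_extDeriv {p : ℕ} {f : EuclideanSpace ℝ (Fin n) → AltForm n p}
    (hf : ContDiff ℝ ∞ f) : ContDiff ℝ ∞ (extDeriv f) :=
  ContDiff.comp (g := ContinuousAlternatingMap.alternatizeUncurryFinCLM ℝ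
    (EuclideanSpace ℝ (Fin n)) ℂ (n := p)) (ContinuousLinearMap.contDiff _)
    (hf.fderiv_right (m := ∞) (by simp))

theorem contDiff_euclCodiff {p : ℕ} {f : EuclideanSpace ℝ (Fin n) → AltForm n (p + 1)}
    (hf : ContDiff ℝ ∞ f) : ContDiff ℝ ∞ (euclCodiff p f) := by
  refine ContDiff.neg (ContDiff.sum fun i _ => ?_)
  exact (interiorProd p (EuclideanSpace.single i (1 : ℝ))).contDiff.comp
    ((hf.fderiv_right (m := ∞) (by simp)).clm_apply contDiff_const)

theorem fderiv_add_forms {p : ℕ} {f g : EuclideanSpace ℝ (Fin n) → AltForm n p}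
    (hf : ContDiff ℝ ∞ f) (hg : ContDiff ℝ ∞ g) (x : EuclideanSpace ℝ (Fin n)) :
    fderiv ℝ (f + g) x = fderiv ℝ f x + fderiv ℝ g x :=
  fderiv_add (hf.differentiable (by simp) x) (hg.differentiable (by simp) x)

theorem fderiv_smul_forms {p : ℕ} {f : EuclideanSpace ℝ (Fin n) → AltForm n p}
    (hf : ContDiff ℝ ∞ f) (c : ℂ) (x : EuclideanSpace ℝ (Fin n)) :
    fderiv ℝ (c • f) x = c • fderiv ℝ f x :=
  fderiv_const_smul (hf.differentiable (by simp) x) c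

/-- The exterior derivative on smooth `p`-forms on the flat torus, computed upstairs on `ℝⁿ`. -/
def extD (Λ : Submodule ℤ (EuclideanSpace ℝ (Fin n))) (p : ℕ) :
    smoothForms Λ p →ₗ[ℂ] smoothForms Λ (p + 1) where
  toFun θ := ⟨descend Λ (extDeriv (pullback Λ θ.1)) (by
      intro l hl x
      unfold extDeriv
      rw [fderiv_periodic (fun l hl x => pullback_add_mem Λ θ.1 hl x) l hl x]),
    contDiff_extDeriv (contDiff_pullback θ)⟩
  map_add' θ η := by
    apply Subtype.ext
    apply pullback_injective
    funext x
    exact extDeriv_add (ω₁ := pullback Λ θ.1) (ω₂ := pullback Λ η.1)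
      ((contDiff_pullback θ).differentiable (by simp) x) ((contDiff_pullback η).differentiable (by simp) x)
  map_smul' c θ := by
    apply Subtype.ext
    apply pullback_injective
    funext x
    change ContinuousAlternatingMap.alternatizeUncurryFin (fderiv ℝ (c • pullback Λ θ.1) x) =
      c • ContinuousAlternatingMap.alternatizeUncurryFin (fderiv ℝ (pullback Λ θ.1) x)
    rw [fderiv_smul_forms (contDiff_pullback θ)]
    exact ContinuousAlternatingMap.alternatizeUncurryFin_smul c _

/-- The codifferential on smooth forms on the flat torus, computed upstairs on `ℝⁿ`. -/
def codiff (Λ : Submodule ℤ (EuclideanSpace ℝ (Fin n))) (p : ℕ) :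
    smoothForms Λ (p + 1) →ₗ[ℂ] smoothForms Λ p where
  toFun η := ⟨descend Λ (euclCodiff p (pullback Λ η.1)) (by
      intro l hl x
      unfold euclCodiff
      rw [fderiv_periodic (fun l hl x => pullback_add_mem Λ η.1 hl x) l hl x]),
    contDiff_euclCodiff (contDiff_pullback η)⟩
  map_add' θ η := by
    apply Subtype.ext
    apply pullback_injective
    funext x
    change euclCodiff p (pullback Λ θ.1 + pullback Λ η.1) x =
      euclCodiff p (pullback Λ θ.1) x + euclCodiff p (pullback Λ η.1) x
    unfold euclCodiff
    rw [fderiv_add_forms (contDiff_pullback θ) (contDiff_pullback η)]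
    simp [Finset.sum_add_distrib, add_comm]
  map_smul' c θ := by
    apply Subtype.ext
    apply pullback_injective
    funext x
    change euclCodiff p (c • pullback Λ θ.1) x = c • euclCodiff p (pullback Λ θ.1) x
    unfold euclCodiff
    rw [fderiv_smul_forms (contDiff_pullback θ)]
    ext v
    simp [interiorProd_apply, Finset.mul_sum]

/-- The pointwise Hermitian inner product of two alternating `p`-forms on `ℝⁿ`, for which the forms
`e^{i₁} ∧ ⋯ ∧ e^{i_p}` with `i₁ < ⋯ < i_p` are orthonormal. It is written as a sum over all index
tuples, in which every increasing tuple is counted `p!` times. -/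
def formInner (p : ℕ) (θ η : AltForm n p) : ℂ :=
  (p.factorial : ℂ)⁻¹ * ∑ I : Fin p → Fin n,
    θ (fun k => EuclideanSpace.single (I k) 1) *
      (starRingEnd ℂ) (η (fun k => EuclideanSpace.single (I k) 1))

/-- The `L²`-scalar product of two `p`-forms on `ℝⁿ / Λ`, as an integral over a fundamental
domain `D` of `Λ`. -/
def l2Inner (Λ : Submodule ℤ (EuclideanSpace ℝ (Fin n))) (D : Set (EuclideanSpace ℝ (Fin n)))
    (p : ℕ) (θ η : smoothForms Λ p) : ℂ :=
  ∫ x in D, formInner p (pullback Λ θ.1 x) (pullback Λ η.1 x)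

theorem formInner_alternatizeUncurryFin (p : ℕ)
    (L : EuclideanSpace ℝ (Fin n) →L[ℝ] AltForm n p) (η : AltForm n (p + 1)) :
    formInner (p + 1) (ContinuousAlternatingMap.alternatizeUncurryFin L) η =
      ∑ i, formInner p (L (EuclideanSpace.single i 1))
        (interiorProd p (EuclideanSpace.single i 1) η) := by
  set e : Fin n → EuclideanSpace ℝ (Fin n) := fun i => EuclideanSpace.single i 1 with he
  have key : ∀ k : Fin (p + 1),
      ∑ I : Fin (p + 1) → Fin n, ((-1) ^ (k : ℕ) • L (e (I k)) (k.removeNth (fun j => e (I j)))) *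
        (starRingEnd ℂ) (η (fun j => e (I j))) =
      ∑ i, ∑ J : Fin p → Fin n, L (e i) (fun j => e (J j)) *
        (starRingEnd ℂ) (η (Matrix.vecCons (e i) (fun j => e (J j)))) := by
    intro k
    rw [← (Fin.insertNthEquiv (fun _ => Fin n) k).sum_comp, Fintype.sum_prod_type]
    refine Finset.sum_congr rfl fun i _ => Finset.sum_congr rfl fun J _ => ?_
    have h1 : (fun j => e ((Fin.insertNthEquiv (fun _ => Fin n) k) (i, J) j)) =
        k.insertNth (α := fun _ => EuclideanSpace ℝ (Fin n)) (e i) (fun j => e (J j)) := by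
      funext j
      refine Fin.succAboveCases k ?_ (fun j => ?_) j <;> simp [Fin.insertNthEquiv]
    have h2 : e ((Fin.insertNthEquiv (fun _ => Fin n) k) (i, J) k) = e i := by
      simp [Fin.insertNthEquiv]
    rw [h1, h2, ContinuousAlternatingMap.map_insertNth]
    rw [Fin.removeNth_insertNth]
    rcases neg_one_pow_eq_or ℤ (k : ℕ) with h | h <;> simp [h]
  unfold formInner
  simp only [ContinuousAlternatingMap.alternatizeUncurryFin_apply, Finset.sum_mul,
    interiorProd_apply]
  rw [Finset.sum_comm, Finset.sum_congr rfl fun k _ => key k]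
  rw [Finset.sum_const, Finset.card_univ, Fintype.card_fin, nsmul_eq_mul, ← mul_assoc,
    ← Finset.mul_sum]
  congr 1
  rw [Nat.factorial_succ]
  have h1 : ((p + 1 : ℕ) : ℂ) ≠ 0 := Nat.cast_ne_zero.2 (by omega)
  have h2 : (p.factorial : ℂ) ≠ 0 := Nat.cast_ne_zero.2 (Nat.factorial_ne_zero p)
  rw [Nat.cast_mul]
  field_simp

open MeasureTheory in
theorem setIntegral_fderiv_periodic (Λ : Submodule ℤ (EuclideanSpace ℝ (Fin n)))
    [DiscreteTopology Λ] [IsZLattice ℝ Λ] {D : Set (EuclideanSpace ℝ (Fin n))}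
    (hD : IsAddFundamentalDomain Λ D volume) (hb : Bornology.IsBounded D)
    {f : EuclideanSpace ℝ (Fin n) → ℂ} (hf : ContDiff ℝ 1 f)
    (hper : ∀ l ∈ Λ, ∀ x, f (x + l) = f x) (v : EuclideanSpace ℝ (Fin n)) :
    ∫ x in D, fderiv ℝ f x v = 0 := by
  have hconst : ∀ t : ℝ, ∫ x in D, f (x + t • v) = ∫ x in D, f x := by
    intro t
    have h1 := (measurePreserving_add_right volume (t • v)).setIntegral_image_emb
      (measurableEmbedding_addRight (t • v)) f D
    rw [← h1]
    have h2 : IsAddFundamentalDomain Λ ((t • v) +ᵥ D) volume := hD.vadd_of_comm (t • v)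
    have h3 : (fun x => x + t • v) '' D = (t • v) +ᵥ D := by
      ext y
      rw [Set.mem_vadd_set]
      simp only [Set.mem_image, vadd_eq_add, add_comm]
    have : VAddInvariantMeasure Λ (EuclideanSpace ℝ (Fin n)) volume :=
      ⟨fun g s _ => measure_preimage_add volume (g : EuclideanSpace ℝ (Fin n)) s⟩
    rw [h3]
    refine h2.setIntegral_eq hD ?_
    intro g x
    rw [← hper g g.2 x, add_comm]
    rfl
  have hfin : volume D < ⊤ := hb.measure_lt_top
  have : IsFiniteMeasure (volume.restrict D) := ⟨by simpa using hfin⟩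
  obtain ⟨R, hR⟩ := hb.subset_closedBall (0 : EuclideanSpace ℝ (Fin n))
  have hcont : Continuous (fun x => fderiv ℝ f x v) :=
    (hf.continuous_fderiv (by simp)).clm_apply continuous_const
  obtain ⟨C, hC⟩ := (isCompact_closedBall (0 : EuclideanSpace ℝ (Fin n))
    (R + ‖v‖)).exists_bound_of_continuousOn hcont.continuousOn
  obtain ⟨C', hC'⟩ := (isCompact_closedBall (0 : EuclideanSpace ℝ (Fin n))
    R).exists_bound_of_continuousOn hf.continuous.continuousOn
  have hmem : ∀ᵐ x ∂(volume.restrict D), x ∈ D := by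
    rw [ae_restrict_iff'₀ hD.nullMeasurableSet]
    exact ae_of_all _ fun x hx => hx
  have hder := hasDerivAt_integral_of_dominated_loc_of_deriv_le (μ := volume.restrict D)
    (F := fun (t : ℝ) x => f (x + t • v)) (F' := fun (t : ℝ) x => fderiv ℝ f (x + t • v) v)
    (x₀ := (0 : ℝ)) (s := Metric.ball 0 1) (bound := fun _ => C)
    (Metric.ball_mem_nhds _ one_pos)
    (Filter.Eventually.of_forall fun t =>
      (hf.continuous.comp (continuous_id.add continuous_const)).aestronglyMeasurable)
    (Integrable.of_bound (hf.continuous.comp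
        (continuous_id.add continuous_const)).aestronglyMeasurable C'
      (hmem.mono fun x hx => by simpa using hC' x (hR hx)))
    (hcont.comp (continuous_id.add continuous_const)).aestronglyMeasurable
    (hmem.mono fun x hx t ht => by
      apply hC
      have h1 : ‖x‖ ≤ R := by simpa using hR hx
      have h2 : |t| < 1 := by simpa using ht
      have h3 : ‖x + t • v‖ ≤ ‖x‖ + |t| * ‖v‖ := by
        simpa [norm_smul] using norm_add_le x (t • v)
      have h4 : |t| * ‖v‖ ≤ 1 * ‖v‖ := by gcongr
      rw [mem_closedBall_zero_iff]
      linarith)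
    (integrable_const C)
    (ae_of_all _ fun x t _ => by
      have h1 : HasDerivAt (fun t : ℝ => x + t • v) v t := by
        simpa using ((hasDerivAt_id t).smul_const v).const_add x
      exact ((hf.differentiable (by simp) (x + t • v)).hasFDerivAt.comp_hasDerivAt t h1))
  have h := hder.2
  simp only [hconst, zero_smul, add_zero] at h
  exact h.unique (hasDerivAt_const _ _)

theorem fderiv_formInner {p : ℕ} {f g : EuclideanSpace ℝ (Fin n) → AltForm n p}
    (hf : ContDiff ℝ ∞ f) (hg : ContDiff ℝ ∞ g) (x v : EuclideanSpace ℝ (Fin n)) :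
    fderiv ℝ (fun y => formInner p (f y) (g y)) x v =
      formInner p (fderiv ℝ f x v) (g x) + formInner p (f x) (fderiv ℝ g x v) := by
  have ha : ∀ w : Fin p → EuclideanSpace ℝ (Fin n), HasFDerivAt (fun y => f y w)
      ((ContinuousAlternatingMap.apply ℝ (EuclideanSpace ℝ (Fin n)) ℂ w).comp (fderiv ℝ f x)) x :=
    fun w => (ContinuousAlternatingMap.apply ℝ (EuclideanSpace ℝ (Fin n)) ℂ w).hasFDerivAt.comp x
      (hf.differentiable (by simp) x).hasFDerivAt
  have hb : ∀ w : Fin p → EuclideanSpace ℝ (Fin n),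
      HasFDerivAt (fun y => (starRingEnd ℂ) (g y w))
      ((Complex.conjCLE : ℂ →L[ℝ] ℂ).comp
        ((ContinuousAlternatingMap.apply ℝ (EuclideanSpace ℝ (Fin n)) ℂ w).comp
          (fderiv ℝ g x))) x :=
    fun w => (Complex.conjCLE : ℂ →L[ℝ] ℂ).hasFDerivAt.comp x
      ((ContinuousAlternatingMap.apply ℝ (EuclideanSpace ℝ (Fin n)) ℂ w).hasFDerivAt.comp x
      (hg.differentiable (by simp) x).hasFDerivAt)
  have h := (HasFDerivAt.fun_sum (u := (Finset.univ : Finset (Fin p → Fin n))) fun I _ =>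
    (ha (fun k => EuclideanSpace.single (I k) 1)).mul
      (hb (fun k => EuclideanSpace.single (I k) 1))).const_mul ((p.factorial : ℂ)⁻¹)
  have h' : fderiv ℝ (fun y => formInner p (f y) (g y)) x = _ := h.fderiv
  rw [h']
  simp only [formInner, smul_apply, sum_apply,
    add_apply, ContinuousLinearMap.comp_apply, smul_eq_mul,
    ContinuousAlternatingMap.apply_apply, ContinuousLinearEquiv.coe_coe,
    Complex.conjCLE_apply]
  rw [← mul_add, ← Finset.sum_add_distrib]
  congr 1
  refine Finset.sum_congr rfl fun I _ => ?_
  ring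

theorem contDiff_formInner {p : ℕ} {f g : EuclideanSpace ℝ (Fin n) → AltForm n p}
    (hf : ContDiff ℝ ∞ f) (hg : ContDiff ℝ ∞ g) :
    ContDiff ℝ ∞ (fun y => formInner p (f y) (g y)) := by
  have ha : ∀ (h : EuclideanSpace ℝ (Fin n) → AltForm n p) (w : Fin p → EuclideanSpace ℝ (Fin n)),
      ContDiff ℝ ∞ h → ContDiff ℝ ∞ (fun y => h y w) := fun h w hh =>
    (ContinuousAlternatingMap.apply ℝ (EuclideanSpace ℝ (Fin n)) ℂ w).contDiff.comp hh
  refine contDiff_const.mul (ContDiff.sum fun I _ => (ha f _ hf).mul ?_)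
  exact (Complex.conjCLE : ℂ →L[ℝ] ℂ).contDiff.comp (ha g _ hg)

open MeasureTheory in
/-- `codiff` is the formal adjoint of the exterior derivative: `(dθ, η) = (θ, δη)`. -/
theorem l2Inner_extD (Λ : Submodule ℤ (EuclideanSpace ℝ (Fin n)))
    [DiscreteTopology Λ] [IsZLattice ℝ Λ] {D : Set (EuclideanSpace ℝ (Fin n))}
    (hD : IsAddFundamentalDomain Λ D volume) (hb : Bornology.IsBounded D)
    (p : ℕ) (θ : smoothForms Λ p) (η : smoothForms Λ (p + 1)) :
    l2Inner Λ D (p + 1) (extD Λ p θ) η = l2Inner Λ D p θ (codiff Λ p η) := by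
  have hθ := contDiff_pullback θ
  have hη := contDiff_pullback η
  have hi : ∀ i : Fin n, ContDiff ℝ ∞
      (fun y => interiorProd p (EuclideanSpace.single i 1) (pullback Λ η.1 y)) := fun i =>
    (interiorProd p (EuclideanSpace.single i (1 : ℝ))).contDiff.comp hη
  have hint : ∀ g : EuclideanSpace ℝ (Fin n) → ℂ, Continuous g → IntegrableOn g D := by
    intro g hg
    obtain ⟨R, hR⟩ := hb.subset_closedBall (0 : EuclideanSpace ℝ (Fin n))
    exact (hg.continuousOn.integrableOn_compact (isCompact_closedBall _ R)).mono_set hR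
  have hdiff : ∀ x, formInner (p + 1) (pullback Λ (extD Λ p θ).1 x) (pullback Λ η.1 x) -
      formInner p (pullback Λ θ.1 x) (pullback Λ (codiff Λ p η).1 x) =
      ∑ i, fderiv ℝ (fun y => formInner p (pullback Λ θ.1 y)
        (interiorProd p (EuclideanSpace.single i 1) (pullback Λ η.1 y))) x
          (EuclideanSpace.single i 1) := by
    intro x
    have h1 : formInner (p + 1) (pullback Λ (extD Λ p θ).1 x) (pullback Λ η.1 x) = _ :=
      formInner_alternatizeUncurryFin p (fderiv ℝ (pullback Λ θ.1) x) (pullback Λ η.1 x)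
    have h2 : formInner p (pullback Λ θ.1 x) (pullback Λ (codiff Λ p η).1 x) =
        - ∑ i, formInner p (pullback Λ θ.1 x) (interiorProd p (EuclideanSpace.single i 1)
          (fderiv ℝ (pullback Λ η.1) x (EuclideanSpace.single i 1))) := by
      change formInner p (pullback Λ θ.1 x) (euclCodiff p (pullback Λ η.1) x) = _
      simp only [formInner, euclCodiff, ContinuousAlternatingMap.neg_apply,
        ContinuousAlternatingMap.sum_apply, map_neg, map_sum, mul_neg, Finset.mul_sum,
        Finset.sum_neg_distrib]
      rw [Finset.sum_comm]
    rw [h1, h2, sub_neg_eq_add, ← Finset.sum_add_distrib]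
    refine Finset.sum_congr rfl fun i _ => ?_
    rw [fderiv_formInner hθ (hi i)]
    congr 2
    have h3 := ((interiorProd p (EuclideanSpace.single i (1 : ℝ))).hasFDerivAt.comp x
      (hη.differentiable (by simp) x).hasFDerivAt).fderiv
    exact (congrArg (fun T => T (EuclideanSpace.single i 1)) h3).symm
  rw [← sub_eq_zero]
  unfold l2Inner
  rw [← integral_sub (hint _ (contDiff_formInner (contDiff_pullback _) hη).continuous)
    (hint _ (contDiff_formInner hθ (contDiff_pullback _)).continuous)]
  simp only [hdiff]
  have hc : ∀ i : Fin n, ContDiff ℝ 1 (fun y => formInner p (pullback Λ θ.1 y)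
        (interiorProd p (EuclideanSpace.single i 1) (pullback Λ η.1 y))) := fun i =>
    (contDiff_formInner hθ (hi i)).of_le (by simp)
  rw [integral_finsetSum _ fun i _ => hint _
    (((hc i).continuous_fderiv (by simp)).clm_apply continuous_const)]
  refine Finset.sum_eq_zero fun i _ => ?_
  refine setIntegral_fderiv_periodic Λ hD hb (hc i) (fun l hl x => ?_) _
  rw [pullback_add_mem Λ θ.1 hl, pullback_add_mem Λ η.1 hl]

/-- The operator `F_{αβ,p} = α d δ + β δ d` on smooth `p`-forms on `ℝⁿ / Λ`
(with `δ = 0` on functions). -/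
def hodgeOp (Λ : Submodule ℤ (EuclideanSpace ℝ (Fin n))) (α β : ℝ) :
    (p : ℕ) → Module.End ℂ (smoothForms Λ p)
  | 0 => (β : ℂ) • (codiff Λ 0 ∘ₗ extD Λ 0)
  | p + 1 => (α : ℂ) • (extD Λ p ∘ₗ codiff Λ p) +
      (β : ℂ) • (codiff Λ (p + 1) ∘ₗ extD Λ (p + 1))

/-- The spectrum of `F_{αβ,p}` on `ℝⁿ / Λ` as a weighted set: the function that assigns to every
complex number the dimension of its eigenspace. -/
def spec (Λ : Submodule ℤ (EuclideanSpace ℝ (Fin n))) (α β : ℝ) (p : ℕ) : ℂ → ℕ :=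
  fun μ => Module.finrank ℂ (Module.End.eigenspace (R := ℂ) (M := smoothForms Λ p) (hodgeOp Λ α β p) μ)

/-- `F_{αβ,p}` on `ℝⁿ / Λ₁` and `F_{α'β',p}` on `ℝⁿ / Λ₂` are isospectral: their spectra agree,
with multiplicities. -/
def Isospectral (p : ℕ) (Λ₁ : Submodule ℤ (EuclideanSpace ℝ (Fin n))) (α β : ℝ)
    (Λ₂ : Submodule ℤ (EuclideanSpace ℝ (Fin n))) (α' β' : ℝ) : Prop :=
  spec Λ₁ α β p = spec Λ₂ α' β' p

end FlatTorus

end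

/-! Fourier expansion on the torus diagonalises the operator. Write `Λ*` for the dual lattice. On
the coefficient at `ξ ∈ Λ*`, `d` acts as `2πi ξ ∧ ·` and `δ` as `-2πi ξ ⌟ ·`, so `F_{αβ,p}` acts as
`4π² (α ξ ∧ (ξ ⌟ ·) + β ξ ⌟ (ξ ∧ ·))`. For a unit vector `u` the map `P = u ∧ (u ⌟ ·)` is a
projection, and `u ⌟ (u ∧ ·) = 1 - P`. Its rank is `C(n-1, p-1)` and its kernel has dimension
`C(n-1, p)`. Hence, with `M` the multiplicity function of the Laplace operator on functions, the
multiplicity of a real `s` is `C(n-1, p-1) M(s/α) + C(n-1, p) M(s/β)` (`spec_latticeOf`).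

Replacing `Λ` by `cΛ` scales `Λ*` by `c⁻¹`, which amounts to dividing `α'` and `β'` by `c²`
(`dilatedMult_scaledBasis`). It remains to recover the dilation factors from a weighted sum of two
dilations of one function `M` that has a least positive point `m` of its support
(`dilations_eq_or_swap`). The least positive point of the sum is `m min(α, β)`, which yields the
smaller factor; the value there shows which weight belongs to it, and cancelling the common term
leaves a single dilation.

The factors can be interchanged only if the two weights agree, that is, if `n = 2p`. For `p = n` the
second weight is zero and only `α` is visible. -/

noncomputable section

open scoped ContDiff

namespace FlatTorus

open MeasureTheory Module

variable {n : ℕ}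

local notation "𝔼" n => EuclideanSpace ℝ (Fin n)

/-! ### Exterior and interior multiplication by a covector. -/

/-- Exterior multiplication of alternating forms by the covector `⟪ξ, ·⟫`. -/
def wedgeCovector (p : ℕ) (ξ : 𝔼 n) : AltForm n p →ₗ[ℂ] AltForm n (p + 1) where
  toFun η := ContinuousAlternatingMap.alternatizeUncurryFin ((innerSL ℝ ξ).smulRight η)
  map_add' η θ := by
    rw [← ContinuousAlternatingMap.alternatizeUncurryFin_add]
    congr 1
    ext v : 1
    exact smul_add (inner ℝ ξ v) η θ
  map_smul' c η := by
    rw [RingHom.id_apply, ← ContinuousAlternatingMap.alternatizeUncurryFin_smul]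
    congr 1
    ext v : 1
    exact smul_comm (inner ℝ ξ v) c η

/-- The interior product with `ξ` as a complex linear map. -/
def contractVector (p : ℕ) (ξ : 𝔼 n) : AltForm n (p + 1) →ₗ[ℂ] AltForm n p where
  toFun := interiorProd p ξ
  map_add' := map_add _
  map_smul' _ _ := rfl

theorem contractVector_apply (p : ℕ) (ξ : 𝔼 n) (η : AltForm n (p + 1)) (w : Fin p → 𝔼 n) :
    contractVector p ξ η w = η (Matrix.vecCons ξ w) := rfl

theorem wedgeCovector_apply (p : ℕ) (ξ : 𝔼 n) (η : AltForm n p) (w : Fin (p + 1) → 𝔼 n) :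
    wedgeCovector p ξ η w =
      ∑ k : Fin (p + 1), (-1 : ℤ) ^ (k : ℕ) • (inner ℝ ξ (w k) • η (k.removeNth w)) := by
  change ContinuousAlternatingMap.alternatizeUncurryFin _ w = _
  rw [ContinuousAlternatingMap.alternatizeUncurryFin_apply]
  rfl

theorem contractVector_contractVector (p : ℕ) (ξ : 𝔼 n) (η : AltForm n (p + 2)) :
    contractVector p ξ (contractVector (p + 1) ξ η) = 0 := by
  ext w
  exact η.map_eq_zero_of_eq _ (i := 0) (j := 1) rfl (by simp)

theorem contractVector_wedgeCovector_zero (ξ : 𝔼 n) (η : AltForm n 0) :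
    contractVector 0 ξ (wedgeCovector 0 ξ η) = (inner ℝ ξ ξ : ℝ) • η := by
  ext w
  rw [contractVector_apply, wedgeCovector_apply]
  simp [Subsingleton.elim _ w]

/-- In the alternating sum for `ξ ∧ η`, the slot filled by `ξ` itself contributes `|ξ|² η`. The
other terms are those of `ξ ∧ (ξ ⌟ η)`, with signs reversed because every index is shifted by one.
-/
theorem contractVector_wedgeCovector (p : ℕ) (ξ : 𝔼 n) (η : AltForm n (p + 1)) :
    contractVector (p + 1) ξ (wedgeCovector (p + 1) ξ η) =
      (inner ℝ ξ ξ : ℝ) • η - wedgeCovector p ξ (contractVector p ξ η) := by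
  ext w
  rw [contractVector_apply, wedgeCovector_apply, Fin.sum_univ_succ]
  have h : ∀ i : Fin (p + 1), i.succ.removeNth (Matrix.vecCons ξ w) =
      Matrix.vecCons ξ (i.removeNth w) := by
    intro i
    funext j
    refine Fin.cases ?_ (fun j => ?_) j <;> simp [Fin.removeNth]
  have h0 : Fin.removeNth 0 (Matrix.vecCons ξ w) = w := by
    funext j
    simp [Fin.removeNth]
  have hr : (((inner ℝ ξ ξ : ℝ) • η - wedgeCovector p ξ (contractVector p ξ η) :
      AltForm n (p + 1))) w = (inner ℝ ξ ξ : ℝ) • η w -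
        wedgeCovector p ξ (contractVector p ξ η) w := rfl
  rw [hr, wedgeCovector_apply]
  simp only [h, h0, contractVector_apply, Fin.val_zero, pow_zero, one_smul,
    Matrix.cons_val_zero, Matrix.cons_val_succ, Fin.val_succ, pow_succ, sub_eq_add_neg,
    mul_neg, mul_one, neg_smul, Finset.sum_neg_distrib]

/-! ### Dimensions of spaces of forms and of the contraction's range and kernel. -/

theorem continuous_multilinearMap_euclidean {p : ℕ}
    (f : MultilinearMap ℝ (fun _ : Fin p => 𝔼 n) ℂ) : Continuous f := by
  have h : ∀ v : Fin p → 𝔼 n, f v = ∑ r : Fin p → Fin n,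
      (∏ i, v i (r i)) • f (fun i => EuclideanSpace.single (r i) (1 : ℝ)) := by
    intro v
    have hv : v = fun i => ∑ j, v i j • EuclideanSpace.single j (1 : ℝ) := by
      funext i
      simpa using ((EuclideanSpace.basisFun (Fin n) ℝ).sum_repr (v i)).symm
    conv_lhs => rw [hv]
    rw [f.map_sum]
    exact Finset.sum_congr rfl fun r _ => f.map_smul_univ _ _
  rw [show (f : (Fin p → 𝔼 n) → ℂ) = _ from funext h]
  fun_prop

/-- Over a finite-dimensional space every alternating map is continuous. -/
def altFormEquiv (n p : ℕ) : AltForm n p ≃ₗ[ℝ] (𝔼 n) [⋀^Fin p]→ₗ[ℝ] ℂ :=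
  LinearEquiv.ofBijective (ContinuousAlternatingMap.toAlternatingMapLinear (R := ℝ))
    ⟨ContinuousAlternatingMap.toAlternatingMap_injective, fun f =>
      ⟨{ f with cont := continuous_multilinearMap_euclidean f.toMultilinearMap }, rfl⟩⟩

theorem finrank_altForm_real (n p : ℕ) : finrank ℝ (AltForm n p) = n.choose p * 2 := by
  rw [((altFormEquiv n p).trans exteriorPower.alternatingMapLinearEquiv).finrank_eq,
    finrank_linearMap, exteriorPower.finrank_eq]
  simp

instance (p : ℕ) : Module.Finite ℝ (AltForm n p) :=
  Module.Finite.equiv ((altFormEquiv n p).trans exteriorPower.alternatingMapLinearEquiv).symm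

instance (p : ℕ) : Module.Finite ℂ (AltForm n p) :=
  Module.Finite.right ℝ ℂ (AltForm n p)

theorem finrank_altForm (n p : ℕ) : finrank ℂ (AltForm n p) = n.choose p := by
  have h := finrank_mul_finrank ℝ ℂ (AltForm n p)
  rw [finrank_altForm_real, Complex.finrank_real_complex] at h
  omega

theorem range_contractVector_zero {ξ : 𝔼 n} (hξ : inner ℝ ξ ξ = (1 : ℝ)) :
    LinearMap.range (contractVector 0 ξ) = ⊤ := by
  rw [LinearMap.range_eq_top]
  exact fun η => ⟨wedgeCovector 0 ξ η, by rw [contractVector_wedgeCovector_zero, hξ, one_smul]⟩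

/-- Exactness of the Koszul complex: by the anticommutation identity, wedging with the unit vector
`ξ` is a contracting homotopy. -/
theorem range_contractVector_succ (p : ℕ) {ξ : 𝔼 n} (hξ : inner ℝ ξ ξ = (1 : ℝ)) :
    LinearMap.range (contractVector (p + 1) ξ) = LinearMap.ker (contractVector p ξ) := by
  ext η
  constructor
  · rintro ⟨θ, rfl⟩
    exact contractVector_contractVector p ξ θ
  · intro h
    refine ⟨wedgeCovector (p + 1) ξ η, ?_⟩
    rw [contractVector_wedgeCovector, LinearMap.mem_ker.1 h, hξ, map_zero, one_smul, sub_zero]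

/-- Exactness turns rank-nullity into a recursion in `p`, which is Pascal's rule. -/
theorem finrank_range_contractVector (p : ℕ) {ξ : 𝔼 (n + 1)} (hξ : inner ℝ ξ ξ = (1 : ℝ)) :
    finrank ℂ (LinearMap.range (contractVector p ξ)) = n.choose p := by
  induction p with
  | zero => rw [range_contractVector_zero hξ, finrank_top, finrank_altForm]; simp
  | succ p ih =>
    have h := LinearMap.finrank_range_add_finrank_ker (contractVector p ξ)
    rw [range_contractVector_succ p hξ]
    rw [ih, finrank_altForm, Nat.choose_succ_succ'] at h
    omega

theorem finrank_ker_contractVector (p : ℕ) {ξ : 𝔼 (n + 1)} (hξ : inner ℝ ξ ξ = (1 : ℝ)) :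
    finrank ℂ (LinearMap.ker (contractVector p ξ)) = n.choose (p + 1) := by
  rw [← range_contractVector_succ p hξ, finrank_range_contractVector _ hξ]

/-! ### The symbol and its eigenspaces. -/

/-- The symbol `4π² (α ξ ∧ (ξ ⌟ ·) + β ξ ⌟ (ξ ∧ ·))` of `F_{αβ}` at the covector `ξ`. -/
def hodgeSymbol (α β : ℝ) (p : ℕ) (ξ : 𝔼 n) : Module.End ℂ (AltForm n (p + 1)) :=
  (α * (4 * Real.pi ^ 2) : ℂ) • (wedgeCovector p ξ ∘ₗ contractVector p ξ) +
    (β * (4 * Real.pi ^ 2) : ℂ) • (contractVector (p + 1) ξ ∘ₗ wedgeCovector (p + 1) ξ)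

/-- The operator is the scalar `s` on the range of `P` and `t` on its kernel, and these are
complementary. The coincidence `s = t` is allowed, and then both contributions count. -/
theorem finrank_ker_projection_combination {V : Type*} [AddCommGroup V] [Module ℂ V]
    [Module.Finite ℂ V] {P : Module.End ℂ V} (hP : P * P = P) (s t μ : ℂ) :
    finrank ℂ (LinearMap.ker (s • P + t • (1 - P) - μ • 1)) =
      (if s = μ then finrank ℂ (LinearMap.range P) else 0) +
        (if t = μ then finrank ℂ (LinearMap.ker P) else 0) := by
  have hPP : ∀ v, P (P v) = P v := fun v => LinearMap.congr_fun hP v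
  have hsum := LinearMap.finrank_range_add_finrank_ker P
  have key : ∀ v, (s • P + t • (1 - P) - μ • 1 : Module.End ℂ V) v =
      (s - μ) • P v + (t - μ) • (v - P v) := by
    intro v
    simp only [LinearMap.sub_apply, LinearMap.add_apply, LinearMap.smul_apply, Module.End.one_apply]
    module
  have proj : ∀ v, (s • P + t • (1 - P) - μ • 1 : Module.End ℂ V) v = 0 →
      (s - μ) • P v = 0 ∧ (t - μ) • (v - P v) = 0 := by
    intro v hv
    rw [key] at hv
    -- Applying `P` isolates the component in its range; subtracting that leaves the component in
    -- its kernel.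
    have h := congrArg P hv
    simp only [map_add, map_smul, map_sub, hPP, sub_self, smul_zero, add_zero, map_zero] at h
    exact ⟨h, by rwa [h, zero_add] at hv⟩
  split_ifs with hs ht ht
  · have : (s • P + t • (1 - P) - μ • 1 : Module.End ℂ V) = 0 := by
      ext v; rw [key, hs, ht]; simp
    rw [this, LinearMap.ker_zero, finrank_top, hsum]
  · rw [add_zero]
    refine congrArg (fun W : Submodule ℂ V => finrank ℂ W) ?_
    ext v
    rw [LinearMap.mem_ker]
    constructor
    · intro hv
      have := (smul_eq_zero.1 (proj v hv).2).resolve_left (sub_ne_zero.2 ht)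
      exact ⟨v, (sub_eq_zero.1 this).symm⟩
    · rintro ⟨w, rfl⟩
      rw [key, hPP, hs]; simp
  · rw [zero_add]
    refine congrArg (fun W : Submodule ℂ V => finrank ℂ W) ?_
    ext v
    rw [LinearMap.mem_ker, LinearMap.mem_ker]
    constructor
    · intro hv
      exact (smul_eq_zero.1 (proj v hv).1).resolve_left (sub_ne_zero.2 hs)
    · intro hv
      rw [key, hv, ht]; simp
  · rw [add_zero, LinearMap.ker_eq_bot'.2, finrank_bot]
    intro v hv
    have h1 := (smul_eq_zero.1 (proj v hv).1).resolve_left (sub_ne_zero.2 hs)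
    have h2 := (smul_eq_zero.1 (proj v hv).2).resolve_left (sub_ne_zero.2 ht)
    rwa [h1, sub_zero] at h2

theorem wedgeCovector_smul (p : ℕ) (r : ℝ) (ξ : 𝔼 n) :
    wedgeCovector p (r • ξ) = (r : ℂ) • wedgeCovector p ξ := by
  ext η w
  simp only [wedgeCovector_apply, LinearMap.smul_apply, ContinuousAlternatingMap.smul_apply,
    Finset.smul_sum, real_inner_smul_left]
  refine Finset.sum_congr rfl fun k _ => ?_
  simp only [zsmul_eq_mul, Complex.real_smul, smul_eq_mul, Complex.ofReal_mul]
  ring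

theorem contractVector_smul (p : ℕ) (r : ℝ) (ξ : 𝔼 n) :
    contractVector p (r • ξ) = (r : ℂ) • contractVector p ξ := by
  ext η w
  simp only [contractVector_apply, LinearMap.smul_apply, ContinuousAlternatingMap.smul_apply]
  exact (η.toMultilinearMap.cons_smul w r ξ).trans (Complex.real_smul ..)

theorem finrank_eigenspace_hodgeSymbol (α β : ℝ) (p : ℕ) (ξ : 𝔼 (n + 1)) (μ : ℂ) :
    finrank ℂ (LinearMap.ker (hodgeSymbol α β p ξ - μ • 1)) =
      (if (α * (4 * Real.pi ^ 2) * ‖ξ‖ ^ 2 : ℂ) = μ then n.choose p else 0) +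
        (if (β * (4 * Real.pi ^ 2) * ‖ξ‖ ^ 2 : ℂ) = μ then n.choose (p + 1) else 0) := by
  -- At `ξ = 0` any unit vector serves, so the zero frequency needs no separate treatment later.
  obtain ⟨u, hu, hξ⟩ : ∃ u : 𝔼 (n + 1), inner ℝ u u = (1 : ℝ) ∧ ξ = ‖ξ‖ • u := by
    rcases eq_or_ne ξ 0 with rfl | h
    · exact ⟨EuclideanSpace.single 0 1, by simp, by simp⟩
    · have h' : ‖ξ‖ ≠ 0 := norm_ne_zero_iff.2 h
      refine ⟨‖ξ‖⁻¹ • ξ, ?_, by rw [smul_smul, mul_inv_cancel₀ h', one_smul]⟩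
      rw [real_inner_smul_left, real_inner_smul_right, real_inner_self_eq_norm_sq]
      field_simp
  set P : Module.End ℂ (AltForm (n + 1) (p + 1)) := wedgeCovector p u ∘ₗ contractVector p u with hPdef
  have h1 : contractVector (p + 1) u ∘ₗ wedgeCovector (p + 1) u = 1 - P := by
    ext1 η
    change contractVector (p + 1) u (wedgeCovector (p + 1) u η) = η - P η
    rw [contractVector_wedgeCovector, hu, one_smul]
    rfl
  -- `η - P η` is a contraction by `u`, hence is killed by a second one. This makes `P` idempotent
  -- with the same kernel as `u ⌟ ·`.
  have h2 : ∀ η, contractVector p u (P η) = contractVector p u η := by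
    intro η
    have h : P η = η - contractVector (p + 1) u (wedgeCovector (p + 1) u η) := by
      change P η = η - (contractVector (p + 1) u ∘ₗ wedgeCovector (p + 1) u) η
      rw [h1]; simp
    rw [h, map_sub, contractVector_contractVector, sub_zero]
  have hP : P * P = P := by
    ext1 η
    exact congrArg (wedgeCovector p u) (h2 η)
  have hker : LinearMap.ker P = LinearMap.ker (contractVector p u) := by
    ext η
    rw [LinearMap.mem_ker, LinearMap.mem_ker]
    constructor
    · intro h; rw [← h2, h, map_zero]
    · intro h; change wedgeCovector p u (contractVector p u η) = 0; rw [h, map_zero]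
  have hk : finrank ℂ (LinearMap.ker P) = n.choose (p + 1) := by
    rw [hker, finrank_ker_contractVector p hu]
  have hr : finrank ℂ (LinearMap.range P) = n.choose p := by
    have := LinearMap.finrank_range_add_finrank_ker P
    rw [hk, finrank_altForm, Nat.choose_succ_succ'] at this
    omega
  have hsym : hodgeSymbol α β p ξ = (α * (4 * Real.pi ^ 2) * ‖ξ‖ ^ 2 : ℂ) • P +
      (β * (4 * Real.pi ^ 2) * ‖ξ‖ ^ 2 : ℂ) • (1 - P) := by
    rw [← h1, hPdef]
    conv_lhs => rw [hξ]
    rw [hodgeSymbol]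
    simp only [wedgeCovector_smul, contractVector_smul, LinearMap.smul_comp, LinearMap.comp_smul,
      smul_smul]
    congr 2 <;> ring
  rw [hsym, finrank_ker_projection_combination hP, hk, hr]

/-! ### Recovering dilation factors from a counting function. -/

/-- Dilating a counting function by `α` determines `α`. -/
theorem dilation_le {M : ℝ → ℕ} {m : ℝ} (hm : 0 < m) (hMm : M m ≠ 0)
    (hM : ∀ s, 0 < s → s < m → M s = 0) {α α' : ℝ} (hα : 0 < α) (hα' : 0 < α')
    (h : ∀ s, M (s / α) = M (s / α')) : α' ≤ α := by
  by_contra! hlt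
  -- At `s = m α` the left side is `M m ≠ 0`, while on the right `m α / α'` lies strictly between
  -- `0` and `m`.
  have h1 := h (m * α)
  rw [mul_div_cancel_right₀ _ hα.ne', hM (m * α / α') (by positivity)] at h1
  · exact hMm h1
  · rw [div_lt_iff₀ hα']
    gcongr

theorem dilation_eq {M : ℝ → ℕ} {m : ℝ} (hm : 0 < m) (hMm : M m ≠ 0)
    (hM : ∀ s, 0 < s → s < m → M s = 0) {α α' : ℝ} (hα : 0 < α) (hα' : 0 < α')
    (h : ∀ s, M (s / α) = M (s / α')) : α = α' :=
  le_antisymm (dilation_le hm hMm hM hα' hα fun s => (h s).symm)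
    (dilation_le hm hMm hM hα hα' h)

/-- The left side is nonzero at `s = m min(α, β)`. If `α'` and `β'` both exceeded `min(α, β)`, both
arguments on the right would fall into the gap `(0, m)`. -/
theorem min_le_min_of_dilations {M : ℝ → ℕ} {m : ℝ} (hm : 0 < m) (hMm : M m ≠ 0)
    (hM : ∀ s, 0 < s → s < m → M s = 0) {a b : ℕ} (ha : 0 < a) (hb : 0 < b) {α β α' β' : ℝ}
    (hα : 0 < α) (hβ : 0 < β)
    (h : ∀ s, a * M (s / α) + b * M (s / β) = a * M (s / α') + b * M (s / β')) :
    min α' β' ≤ min α β := by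
  by_contra! hlt
  have hmin : 0 < min α β := lt_min hα hβ
  have vanish : ∀ γ, min α β < γ → M (m * min α β / γ) = 0 := by
    intro γ hγ
    have : 0 < γ := hmin.trans hγ
    apply hM _ (by positivity)
    rw [div_lt_iff₀ this]
    gcongr
  have h1 := h (m * min α β)
  rw [vanish α' (lt_of_lt_of_le hlt (min_le_left _ _)),
    vanish β' (lt_of_lt_of_le hlt (min_le_right _ _)), mul_zero, mul_zero, add_zero,
    Nat.add_eq_zero_iff, mul_eq_zero, mul_eq_zero] at h1
  rcases le_total α β with hle | hle
  · rw [min_eq_left hle, mul_div_cancel_right₀ _ hα.ne'] at h1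
    exact h1.1.elim ha.ne' hMm
  · rw [min_eq_right hle, mul_div_cancel_right₀ _ hβ.ne'] at h1
    exact h1.2.elim hb.ne' hMm

/-- Comparing least positive points gives `α = min α' β'`. If this is `α'`, cancelling leaves one
dilation. If it is `β' < α'`, the values at `m α` compare the weights. -/
theorem dilations_eq_or_swap_of_le {M : ℝ → ℕ} {m : ℝ} (hm : 0 < m) (hMm : M m ≠ 0)
    (hM : ∀ s, 0 < s → s < m → M s = 0) {a b : ℕ} (ha : 0 < a) (hb : 0 < b) {α β α' β' : ℝ}
    (hα : 0 < α) (hβ : 0 < β) (hα' : 0 < α') (hβ' : 0 < β') (hle : α ≤ β)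
    (h : ∀ s, a * M (s / α) + b * M (s / β) = a * M (s / α') + b * M (s / β')) :
    (α = α' ∧ β = β') ∨ (a = b ∧ α = β' ∧ β = α') := by
  have hmin : α = min α' β' := by
    rw [← min_eq_left hle]
    exact le_antisymm (min_le_min_of_dilations hm hMm hM ha hb hα' hβ' fun s => (h s).symm)
      (min_le_min_of_dilations hm hMm hM ha hb hα hβ h)
  have cancel : α = α' → β = β' := fun e =>
    dilation_eq hm hMm hM hβ hβ' fun s => by
      have := h s
      rw [← e] at this
      exact Nat.eq_of_mul_eq_mul_left hb (Nat.add_left_cancel this)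
  rcases le_or_gt α' β' with hle' | hlt
  · rw [min_eq_left hle'] at hmin
    exact Or.inl ⟨hmin, cancel hmin⟩
  · rw [min_eq_right hlt.le] at hmin
    have vanish : ∀ γ, α < γ → M (m * α / γ) = 0 := by
      intro γ hγ
      have : 0 < γ := hα.trans hγ
      apply hM _ (by positivity)
      rw [div_lt_iff₀ this]
      gcongr
    have h1 := h (m * α)
    rw [← hmin, mul_div_cancel_right₀ _ hα.ne', vanish α' (hmin ▸ hlt), mul_zero, zero_add] at h1
    -- If `α = β`, the values at `m α` are `(a + b) M m` and `b M m`, which is impossible. Otherwise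
    -- they are `a M m` and `b M m`, so the weights agree.
    rcases hle.eq_or_lt with e | hlt'
    · rw [← e, mul_div_cancel_right₀ _ hα.ne'] at h1
      have : a * M m = 0 := by omega
      exact ((mul_eq_zero.1 this).elim ha.ne' hMm).elim
    · rw [vanish β hlt', mul_zero, add_zero] at h1
      have hab : a = b := Nat.eq_of_mul_eq_mul_right (Nat.pos_of_ne_zero hMm) h1
      refine Or.inr ⟨hab, hmin, dilation_eq hm hMm hM hβ hα' fun s => ?_⟩
      have := h s
      rw [← hmin, hab, add_comm] at this
      exact Nat.eq_of_mul_eq_mul_left hb (Nat.add_right_cancel this)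

/-- A sum of two weighted dilations of a counting function with a least positive point determines
the dilation factors, up to a swap if the weights agree. -/
theorem dilations_eq_or_swap {M : ℝ → ℕ} {m : ℝ} (hm : 0 < m) (hMm : M m ≠ 0)
    (hM : ∀ s, 0 < s → s < m → M s = 0) {a b : ℕ} (ha : 0 < a) (hb : 0 < b) {α β α' β' : ℝ}
    (hα : 0 < α) (hβ : 0 < β) (hα' : 0 < α') (hβ' : 0 < β')
    (h : ∀ s, a * M (s / α) + b * M (s / β) = a * M (s / α') + b * M (s / β')) :
    (α = α' ∧ β = β') ∨ (a = b ∧ α = β' ∧ β = α') := by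
  rcases le_total α β with hle | hle
  · exact dilations_eq_or_swap_of_le hm hMm hM ha hb hα hβ hα' hβ' hle h
  · rcases dilations_eq_or_swap_of_le hm hMm hM hb ha hβ hα hβ' hα' hle
      (fun s => by have := h s; omega) with ⟨h1, h2⟩ | ⟨h1, h2, h3⟩
    · exact Or.inl ⟨h2, h1⟩
    · exact Or.inr ⟨h1.symm, h3, h2⟩

/-! ### The dual lattice and plane waves. -/

/-- The vector of the dual lattice with integral coordinates `k` with respect to the dual basis
of `b`. -/
def freq (b : Basis (Fin n) ℝ (𝔼 n)) (k : Fin n → ℤ) : 𝔼 n :=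
  (InnerProductSpace.toDual ℝ (𝔼 n)).symm
    (LinearMap.toContinuousLinearMap (∑ i, (k i : ℝ) • b.coord i))

theorem inner_freq (b : Basis (Fin n) ℝ (𝔼 n)) (k : Fin n → ℤ) (x : 𝔼 n) :
    inner ℝ (freq b k) x = ∑ i, (k i : ℝ) * b.repr x i := by
  rw [freq, InnerProductSpace.toDual_symm_apply]
  simp

theorem inner_freq_basis (b : Basis (Fin n) ℝ (𝔼 n)) (k : Fin n → ℤ) (i : Fin n) :
    inner ℝ (freq b k) (b i) = (k i : ℝ) := by
  rw [inner_freq]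
  simp [Finsupp.single_apply]

theorem freq_injective (b : Basis (Fin n) ℝ (𝔼 n)) : Function.Injective (freq b) := by
  intro k l h
  funext i
  have := inner_freq_basis b k i
  rw [h, inner_freq_basis] at this
  exact_mod_cast this.symm

theorem freq_sub (b : Basis (Fin n) ℝ (𝔼 n)) (k l : Fin n → ℤ) :
    freq b (k - l) = freq b k - freq b l := by
  refine ext_inner_right ℝ fun x => ?_
  rw [inner_sub_left, inner_freq, inner_freq, inner_freq, ← Finset.sum_sub_distrib]
  refine Finset.sum_congr rfl fun i _ => ?_
  rw [Pi.sub_apply, Int.cast_sub, sub_mul]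

theorem freq_zero (b : Basis (Fin n) ℝ (𝔼 n)) : freq b 0 = 0 := by
  simpa using freq_sub b 0 0

theorem freq_neg (b : Basis (Fin n) ℝ (𝔼 n)) (k : Fin n → ℤ) : freq b (-k) = -freq b k := by
  simpa [freq_zero] using freq_sub b 0 k

theorem inner_freq_mem_lattice (b : Basis (Fin n) ℝ (𝔼 n)) (k : Fin n → ℤ) {l : 𝔼 n}
    (hl : l ∈ Submodule.span ℤ (Set.range b)) : ∃ m : ℤ, inner ℝ (freq b k) l = (m : ℝ) := by
  induction hl using Submodule.span_induction with
  | mem x hx =>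
    obtain ⟨i, rfl⟩ := hx
    exact ⟨k i, inner_freq_basis b k i⟩
  | zero => exact ⟨0, by simp⟩
  | add x y _ _ hx hy =>
    obtain ⟨r, hr⟩ := hx
    obtain ⟨s, hs⟩ := hy
    exact ⟨r + s, by rw [inner_add_right, hr, hs, Int.cast_add]⟩
  | smul a x _ hx =>
    obtain ⟨r, hr⟩ := hx
    refine ⟨a * r, ?_⟩
    rw [← Int.cast_smul_eq_zsmul ℝ, inner_smul_right, hr, Int.cast_mul]

/-- The set of frequencies in a ball is finite. -/
theorem finite_freq_norm_le (b : Basis (Fin n) ℝ (𝔼 n)) (R : ℝ) :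
    {k : Fin n → ℤ | ‖freq b k‖ ≤ R}.Finite := by
  -- The coordinate `k i` is the inner product with `b i`, so Cauchy-Schwarz bounds it by `R ‖b i‖`.
  refine (Set.Finite.pi' fun i => Set.finite_Icc (-⌈R * ‖b i‖⌉) ⌈R * ‖b i‖⌉).subset ?_
  intro k hk i
  have h1 : |(k i : ℝ)| ≤ R * ‖b i‖ := by
    rw [← inner_freq_basis b k i]
    exact (abs_real_inner_le_norm _ _).trans (mul_le_mul_of_nonneg_right hk (norm_nonneg _))
  have h2 : |(k i : ℝ)| ≤ (⌈R * ‖b i‖⌉ : ℝ) := h1.trans (Int.le_ceil _)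
  rw [Set.mem_Icc, ← abs_le]
  exact_mod_cast h2

/-- The plane wave `x ↦ exp (2πi ⟪ξ, x⟫)`. -/
def planeWave (ξ x : 𝔼 n) : ℂ := Complex.exp (2 * Real.pi * Complex.I * (inner ℝ ξ x : ℝ))

theorem planeWave_zero (x : 𝔼 n) : planeWave 0 x = 1 := by simp [planeWave]

theorem planeWave_add (ξ η x : 𝔼 n) : planeWave (ξ + η) x = planeWave ξ x * planeWave η x := by
  rw [planeWave, planeWave, planeWave, ← Complex.exp_add, inner_add_left]
  push_cast
  ring_nf

theorem hasFDerivAt_planeWave (ξ x : 𝔼 n) : HasFDerivAt (planeWave ξ)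
    ((innerSL ℝ ξ).smulRight (2 * Real.pi * Complex.I * planeWave ξ x)) x := by
  have h1 : HasFDerivAt (fun y : 𝔼 n => 2 * Real.pi * Complex.I * ((inner ℝ ξ y : ℝ) : ℂ))
      ((2 * Real.pi * Complex.I : ℂ) • (Complex.ofRealCLM.comp (innerSL ℝ ξ))) x :=
    ((Complex.ofRealCLM.comp (innerSL ℝ ξ)).hasFDerivAt).const_mul _
  refine h1.cexp.congr_fderiv ?_
  ext v
  simp [planeWave]
  ring

theorem contDiff_planeWave (ξ : 𝔼 n) : ContDiff ℝ ∞ (planeWave ξ) := by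
  refine ContDiff.cexp (contDiff_const.mul ?_)
  exact (Complex.ofRealCLM.comp (innerSL ℝ ξ)).contDiff

theorem planeWave_periodic (b : Basis (Fin n) ℝ (𝔼 n)) (k : Fin n → ℤ) :
    ∀ l ∈ Submodule.span ℤ (Set.range b), ∀ x,
      planeWave (freq b k) (x + l) = planeWave (freq b k) x := by
  intro l hl x
  obtain ⟨m, hm⟩ := inner_freq_mem_lattice b k hl
  rw [planeWave, planeWave, inner_add_right, hm]
  push_cast
  rw [mul_add, Complex.exp_add, show 2 * (Real.pi : ℂ) * Complex.I * m = m * (2 * Real.pi * Complex.I) by ring,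
    Complex.exp_int_mul_two_pi_mul_I, mul_one]

theorem integrableOn_fundamentalDomain (b : Basis (Fin n) ℝ (𝔼 n)) {F : Type*}
    [NormedAddCommGroup F] {f : (𝔼 n) → F} (hf : Continuous f) :
    IntegrableOn f (ZSpan.fundamentalDomain b) := by
  obtain ⟨R, hR⟩ := (ZSpan.fundamentalDomain_isBounded b).subset_closedBall (0 : 𝔼 n)
  exact (hf.continuousOn.integrableOn_compact (isCompact_closedBall _ R)).mono_set hR

/-- The derivative of the wave along its own frequency `ξ` is `2πi |ξ|²` times the wave, and
derivatives of periodic functions integrate to zero. -/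
theorem setIntegral_planeWave (b : Basis (Fin n) ℝ (𝔼 n)) {k : Fin n → ℤ} (hk : k ≠ 0) :
    ∫ x in ZSpan.fundamentalDomain b, planeWave (freq b k) x = 0 := by
  have h := setIntegral_fderiv_periodic (Submodule.span ℤ (Set.range b))
    (ZSpan.isAddFundamentalDomain b volume) (ZSpan.fundamentalDomain_isBounded b)
    ((contDiff_planeWave (freq b k)).of_le (by simp)) (planeWave_periodic b k) (freq b k)
  have hne : freq b k ≠ 0 := by
    rw [← freq_zero b]
    exact (freq_injective b).ne hk
  have h1 : ∀ x, fderiv ℝ (planeWave (freq b k)) x (freq b k) =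
      ((‖freq b k‖ ^ 2 : ℝ) : ℂ) * (2 * Real.pi * Complex.I) * planeWave (freq b k) x := by
    intro x
    rw [(hasFDerivAt_planeWave _ x).fderiv, ContinuousLinearMap.smulRight_apply, innerSL_apply_apply,
      real_inner_self_eq_norm_sq, Complex.real_smul]
    ring
  simp only [h1] at h
  rw [integral_const_mul] at h
  refine (mul_eq_zero.1 h).resolve_left (mul_ne_zero ?_ Complex.two_pi_I_ne_zero)
  exact_mod_cast (pow_pos (norm_pos_iff.2 hne) 2).ne'

/-! ### Completeness of the plane waves. -/

/-- The projection `ℝⁿ → (ℝ/ℤ)ⁿ` with respect to the coordinates given by `b`. -/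
def toUnitTorus (b : Basis (Fin n) ℝ (𝔼 n)) (x : 𝔼 n) : UnitAddTorus (Fin n) :=
  fun i => ((b.repr x i : ℝ) : UnitAddCircle)

theorem isOpenQuotientMap_toUnitTorus (b : Basis (Fin n) ℝ (𝔼 n)) :
    IsOpenQuotientMap (toUnitTorus b) :=
  (IsOpenQuotientMap.piMap (f := fun (_ : Fin n) (t : ℝ) => (t : UnitAddCircle))
    fun _ => QuotientAddGroup.isOpenQuotientMap_mk).comp
      b.equivFunL.toHomeomorph.isOpenQuotientMap

theorem mFourier_toUnitTorus (b : Basis (Fin n) ℝ (𝔼 n)) (k : Fin n → ℤ) (x : 𝔼 n) :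
    UnitAddTorus.mFourier k (toUnitTorus b x) = planeWave (freq b k) x := by
  rw [planeWave, inner_freq, UnitAddTorus.mFourier, ContinuousMap.coe_mk]
  simp only [toUnitTorus, fourier_coe_apply]
  rw [← Complex.exp_sum]
  push_cast
  rw [Finset.mul_sum]
  congr 1
  refine Finset.sum_congr rfl fun i _ => ?_
  rw [div_one]
  ring

theorem sub_mem_lattice_of_toUnitTorus_eq (b : Basis (Fin n) ℝ (𝔼 n)) {x y : 𝔼 n}
    (h : toUnitTorus b x = toUnitTorus b y) : x - y ∈ Submodule.span ℤ (Set.range b) := by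
  rw [Basis.mem_span_iff_repr_mem ℤ b]
  intro i
  have h1 : ((b.repr (x - y) i : ℝ) : UnitAddCircle) = 0 := by
    rw [map_sub, Finsupp.sub_apply, AddCircle.coe_sub, sub_eq_zero]
    exact congrFun h i
  obtain ⟨m, hm⟩ := (AddCircle.coe_eq_zero_iff 1).1 h1
  exact ⟨m, by simpa using hm⟩

/-- The set where `f ≠ 0` is lattice invariant and null in a fundamental domain, hence null;
continuity does the rest. -/
theorem eq_zero_of_setIntegral_norm_sq (b : Basis (Fin n) ℝ (𝔼 n)) {f : (𝔼 n) → ℂ}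
    (hf : Continuous f) (hper : ∀ l ∈ Submodule.span ℤ (Set.range b), ∀ x, f (x + l) = f x)
    (h : ∫ x in ZSpan.fundamentalDomain b, ‖f x‖ ^ 2 = 0) : f = 0 := by
  have hD := ZSpan.isAddFundamentalDomain b (volume : Measure (𝔼 n))
  rw [setIntegral_eq_zero_iff_of_nonneg_ae (Filter.Eventually.of_forall fun x => by positivity)
    (integrableOn_fundamentalDomain b (by fun_prop)), Filter.EventuallyEq,
    ae_restrict_iff'₀ hD.nullMeasurableSet] at h
  have h0 : volume ({x | f x ≠ 0} ∩ ZSpan.fundamentalDomain b) = 0 := by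
    refine measure_mono_null ?_ h
    rintro x ⟨hx, hxD⟩ hx'
    exact hx (by simpa using hx' hxD)
  have : VAddInvariantMeasure (Submodule.span ℤ (Set.range b)) (𝔼 n) volume :=
    ⟨fun g s _ => measure_preimage_add volume (g : 𝔼 n) s⟩
  have h1 := hD.measure_zero_of_invariant {x | f x ≠ 0} (fun g => by
    ext x
    rw [Set.mem_vadd_set_iff_neg_vadd_mem]
    have : f (-g +ᵥ x) = f x := by
      rw [← hper _ (-g).2 x, add_comm]
      rfl
    simp only [Set.mem_ofPred_eq, this]) h0
  exact (Continuous.ae_eq_iff_eq volume hf continuous_const).1 h1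

/-- A continuous periodic function all of whose Fourier coefficients vanish is zero. -/
theorem eq_zero_of_fourier_coefficients (b : Basis (Fin n) ℝ (𝔼 n)) {f : (𝔼 n) → ℂ}
    (hf : Continuous f) (hper : ∀ l ∈ Submodule.span ℤ (Set.range b), ∀ x, f (x + l) = f x)
    (h : ∀ k, ∫ x in ZSpan.fundamentalDomain b, planeWave (freq b k) x * f x = 0) : f = 0 := by
  have hcont : ∀ g : C(UnitAddTorus (Fin n), ℂ), Continuous fun x => g (toUnitTorus b x) * f x :=
    fun g => (g.continuous.comp (isOpenQuotientMap_toUnitTorus b).continuous).mul hf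
  have hint : ∀ g : C(UnitAddTorus (Fin n), ℂ),
      IntegrableOn (fun x => g (toUnitTorus b x) * f x) (ZSpan.fundamentalDomain b) :=
    fun g => integrableOn_fundamentalDomain b (hcont g)
  -- Integration against `f` is continuous in the sup norm and vanishes on trigonometric
  -- polynomials, which are dense in the continuous functions on the torus.
  let φ : C(UnitAddTorus (Fin n), ℂ) →L[ℂ] ℂ := LinearMap.mkContinuous
    { toFun := fun g => ∫ x in ZSpan.fundamentalDomain b, g (toUnitTorus b x) * f x
      map_add' := fun g g' => by
        rw [← integral_add (hint g) (hint g')]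
        simp only [ContinuousMap.add_apply, add_mul]
      map_smul' := fun c g => by
        rw [RingHom.id_apply, smul_eq_mul, ← integral_const_mul]
        simp only [ContinuousMap.smul_apply, smul_eq_mul, mul_assoc] }
    (∫ x in ZSpan.fundamentalDomain b, ‖f x‖) (fun g => by
      refine (norm_integral_le_integral_norm _).trans ?_
      rw [mul_comm, ← integral_const_mul]
      refine integral_mono (hint g).norm
        (integrableOn_fundamentalDomain b (by fun_prop)) fun x => ?_
      rw [norm_mul]
      exact mul_le_mul_of_nonneg_right (g.norm_coe_le_norm _) (norm_nonneg _))
  have hφ : ∀ g, φ g = 0 := by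
    have hle : (Submodule.span ℂ (Set.range (UnitAddTorus.mFourier (d := Fin n)))).topologicalClosure
        ≤ LinearMap.ker φ.toLinearMap := by
      refine Submodule.topologicalClosure_minimal _ ?_ φ.isClosed_ker
      rw [Submodule.span_le]
      rintro _ ⟨k, rfl⟩
      change ∫ x in ZSpan.fundamentalDomain b,
        UnitAddTorus.mFourier k (toUnitTorus b x) * f x = 0
      simp only [mFourier_toUnitTorus]
      exact h k
    rw [UnitAddTorus.span_mFourier_closure_eq_top] at hle
    exact fun g => hle (Submodule.mem_top (x := g))
  -- The conjugate of `f` descends to the torus. Testing against it yields `∫ |f|² = 0`.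
  obtain ⟨g₀, hg₀⟩ : ∃ g₀ : C(UnitAddTorus (Fin n), ℂ),
      ∀ x, g₀ (toUnitTorus b x) = (starRingEnd ℂ) (f x) := by
    let π : C(𝔼 n, UnitAddTorus (Fin n)) :=
      ⟨toUnitTorus b, (isOpenQuotientMap_toUnitTorus b).continuous⟩
    have hπ : Topology.IsQuotientMap π := (isOpenQuotientMap_toUnitTorus b).isQuotientMap
    let g : C(𝔼 n, ℂ) := ⟨fun x => (starRingEnd ℂ) (f x), by fun_prop⟩
    have hg : Function.FactorsThrough g π := fun x y hxy => by
      have h1 := hper _ (sub_mem_lattice_of_toUnitTorus_eq b hxy) y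
      rw [add_sub_cancel] at h1
      exact congrArg (starRingEnd ℂ) h1
    exact ⟨hπ.lift g hg, fun x => DFunLike.congr_fun (hπ.lift_comp g hg) x⟩
  refine eq_zero_of_setIntegral_norm_sq b hf hper ?_
  have h2 : ∫ x in ZSpan.fundamentalDomain b, g₀ (toUnitTorus b x) * f x = 0 := hφ g₀
  simp only [hg₀, Complex.conj_mul', ← Complex.ofReal_pow] at h2
  rw [integral_complex_ofReal] at h2
  exact_mod_cast h2

/-! ### Fourier coefficients of forms, and the operator on them. -/

/-- The Fourier coefficient `∫_D e^{-2πi ⟪ξ, x⟫} f x` over the fundamental domain of `b`. -/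
def fourierInt (b : Basis (Fin n) ℝ (𝔼 n)) {p : ℕ} (ξ : 𝔼 n) (f : (𝔼 n) → AltForm n p) :
    AltForm n p :=
  ∫ x in ZSpan.fundamentalDomain b, planeWave (-ξ) x • f x

theorem integrableOn_planeWave_smul (b : Basis (Fin n) ℝ (𝔼 n)) {p : ℕ} (ξ : 𝔼 n)
    {f : (𝔼 n) → AltForm n p} (hf : Continuous f) :
    IntegrableOn (fun x => planeWave ξ x • f x) (ZSpan.fundamentalDomain b) :=
  integrableOn_fundamentalDomain b ((contDiff_planeWave ξ).continuous.smul hf)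

theorem fourierInt_apply (b : Basis (Fin n) ℝ (𝔼 n)) {p : ℕ} (ξ : 𝔼 n)
    {f : (𝔼 n) → AltForm n p} (hf : Continuous f) (w : Fin p → 𝔼 n) :
    fourierInt b ξ f w = ∫ x in ZSpan.fundamentalDomain b, planeWave (-ξ) x * f x w :=
  ((ContinuousAlternatingMap.apply ℝ (𝔼 n) ℂ w).integral_comp_comm
    (integrableOn_planeWave_smul b (-ξ) hf)).symm

theorem integrableOn_planeWave_mul (b : Basis (Fin n) ℝ (𝔼 n)) (ξ : 𝔼 n)
    {f : (𝔼 n) → ℂ} (hf : Continuous f) :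
    IntegrableOn (fun x => planeWave ξ x * f x) (ZSpan.fundamentalDomain b) :=
  integrableOn_fundamentalDomain b ((contDiff_planeWave ξ).continuous.mul hf)

theorem continuous_fderiv_apply_apply {p : ℕ} {f : (𝔼 n) → AltForm n p} (hf : ContDiff ℝ ∞ f)
    (v : 𝔼 n) (w : Fin p → 𝔼 n) : Continuous fun x => fderiv ℝ f x v w :=
  (ContinuousAlternatingMap.apply ℝ (𝔼 n) ℂ w).continuous.comp
    ((hf.continuous_fderiv (by simp)).clm_apply continuous_const)

/-- Integration by parts against a plane wave. -/
theorem fourierInt_fderiv (b : Basis (Fin n) ℝ (𝔼 n)) {p : ℕ} (k : Fin n → ℤ)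
    {f : (𝔼 n) → AltForm n p} (hf : ContDiff ℝ ∞ f)
    (hper : ∀ l ∈ Submodule.span ℤ (Set.range b), ∀ x, f (x + l) = f x)
    (v : 𝔼 n) (w : Fin p → 𝔼 n) :
    ∫ x in ZSpan.fundamentalDomain b, planeWave (-freq b k) x * fderiv ℝ f x v w =
      2 * Real.pi * Complex.I * (inner ℝ (freq b k) v • fourierInt b (freq b k) f w) := by
  have hfw : ContDiff ℝ ∞ fun x => f x w :=
    (ContinuousAlternatingMap.apply ℝ (𝔼 n) ℂ w).contDiff.comp hf
  have h := setIntegral_fderiv_periodic (Submodule.span ℤ (Set.range b))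
    (ZSpan.isAddFundamentalDomain b volume) (ZSpan.fundamentalDomain_isBounded b)
    (f := fun x => planeWave (-freq b k) x * f x w)
    (((contDiff_planeWave (-freq b k)).mul hfw).of_le (by simp))
    (fun l hl x => by rw [hper l hl, ← freq_neg, planeWave_periodic b (-k) l hl]) v
  have hd : ∀ x, fderiv ℝ (fun x => planeWave (-freq b k) x * f x w) x v =
      planeWave (-freq b k) x * fderiv ℝ f x v w -
        (2 * Real.pi * Complex.I * (inner ℝ (freq b k) v : ℝ)) *
          (planeWave (-freq b k) x * f x w) := by
    intro x
    have h1 : HasFDerivAt (fun y => f y w)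
        ((ContinuousAlternatingMap.apply ℝ (𝔼 n) ℂ w).comp (fderiv ℝ f x)) x :=
      (ContinuousAlternatingMap.apply ℝ (𝔼 n) ℂ w).hasFDerivAt.comp x
        (hf.differentiable (by simp) x).hasFDerivAt
    have h2 := ((hasFDerivAt_planeWave (-freq b k) x).mul h1).fderiv
    refine (congrArg (fun T : (𝔼 n) →L[ℝ] ℂ => T v) h2).trans ?_
    simp
    ring
  simp only [hd] at h
  rw [integral_sub (integrableOn_planeWave_mul b _ (continuous_fderiv_apply_apply hf v w))
    ((integrableOn_planeWave_mul b _ hfw.continuous).const_mul _), integral_const_mul,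
    ← fourierInt_apply b _ hf.continuous, sub_eq_zero] at h
  rw [h, Complex.real_smul]
  ring

theorem fourierInt_extDeriv (b : Basis (Fin n) ℝ (𝔼 n)) {p : ℕ} (k : Fin n → ℤ)
    {f : (𝔼 n) → AltForm n p} (hf : ContDiff ℝ ∞ f)
    (hper : ∀ l ∈ Submodule.span ℤ (Set.range b), ∀ x, f (x + l) = f x) :
    fourierInt b (freq b k) (extDeriv f) =
      (2 * Real.pi * Complex.I : ℂ) • wedgeCovector p (freq b k) (fourierInt b (freq b k) f) := by
  ext w
  rw [fourierInt_apply b _ (contDiff_extDeriv hf).continuous,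
    ContinuousAlternatingMap.smul_apply, wedgeCovector_apply, Finset.smul_sum]
  have h1 : ∀ x, planeWave (-freq b k) x * extDeriv f x w = ∑ i : Fin (p + 1), (-1 : ℂ) ^ (i : ℕ) *
      (planeWave (-freq b k) x * fderiv ℝ f x (w i) (i.removeNth w)) := by
    intro x
    rw [extDeriv, ContinuousAlternatingMap.alternatizeUncurryFin_apply, Finset.mul_sum]
    refine Finset.sum_congr rfl fun i _ => ?_
    rw [zsmul_eq_mul]
    push_cast
    ring
  simp only [h1]
  rw [integral_finsetSum _ fun i _ =>
    (integrableOn_planeWave_mul b _ (continuous_fderiv_apply_apply hf _ _)).const_mul _]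
  refine Finset.sum_congr rfl fun i _ => ?_
  rw [integral_const_mul, fourierInt_fderiv b k hf hper, zsmul_eq_mul, smul_eq_mul]
  push_cast
  ring

theorem fourierInt_euclCodiff (b : Basis (Fin n) ℝ (𝔼 n)) {p : ℕ} (k : Fin n → ℤ)
    {f : (𝔼 n) → AltForm n (p + 1)} (hf : ContDiff ℝ ∞ f)
    (hper : ∀ l ∈ Submodule.span ℤ (Set.range b), ∀ x, f (x + l) = f x) :
    fourierInt b (freq b k) (euclCodiff p f) =
      -(2 * Real.pi * Complex.I : ℂ) •
        contractVector p (freq b k) (fourierInt b (freq b k) f) := by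
  ext w
  rw [fourierInt_apply b _ (contDiff_euclCodiff hf).continuous,
    ContinuousAlternatingMap.smul_apply, contractVector_apply]
  have h1 : ∀ x, planeWave (-freq b k) x * euclCodiff p f x w = -∑ i : Fin n,
      planeWave (-freq b k) x * fderiv ℝ f x (EuclideanSpace.single i 1)
        (Matrix.vecCons (EuclideanSpace.single i 1) w) := by
    intro x
    rw [euclCodiff, ContinuousAlternatingMap.neg_apply, ContinuousAlternatingMap.sum_apply,
      mul_neg, Finset.mul_sum]
    rfl
  -- The codifferential is a sum over the standard basis; linearity in the first slot assembles it
  -- into contraction with the frequency.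
  have h2 : fourierInt b (freq b k) f (Matrix.vecCons (freq b k) w) =
      ∑ i, freq b k i • fourierInt b (freq b k) f
        (Matrix.vecCons (EuclideanSpace.single i (1 : ℝ)) w) := by
    set g := fourierInt b (freq b k) f
    let ψ : (𝔼 n) →ₗ[ℝ] ℂ :=
      { toFun := fun v => g (Matrix.vecCons v w)
        map_add' := fun x y => g.toMultilinearMap.cons_add w x y
        map_smul' := fun c x => g.toMultilinearMap.cons_smul w c x }
    change ψ (freq b k) = ∑ i, freq b k i • ψ (EuclideanSpace.single i 1)
    have h3 := (EuclideanSpace.basisFun (Fin n) ℝ).sum_repr (freq b k)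
    conv_lhs => rw [← h3]
    simp
  simp only [h1]
  rw [integral_neg, integral_finsetSum _ fun i _ =>
    integrableOn_planeWave_mul b _ (continuous_fderiv_apply_apply hf _ _), h2, neg_smul,
    Finset.smul_sum]
  congr 1
  refine Finset.sum_congr rfl fun i _ => ?_
  rw [fourierInt_fderiv b k hf hper, smul_eq_mul]
  simp [EuclideanSpace.inner_single_right]

/-- The lattice spanned by a basis of `ℝⁿ`. -/
abbrev latticeOf (b : Basis (Fin n) ℝ (𝔼 n)) : Submodule ℤ (𝔼 n) :=
  Submodule.span ℤ (Set.range b)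

/-- The volume of the fundamental domain of `b`. -/
def covol (b : Basis (Fin n) ℝ (𝔼 n)) : ℂ :=
  ((volume (ZSpan.fundamentalDomain b)).toReal : ℂ)

theorem covol_ne_zero (b : Basis (Fin n) ℝ (𝔼 n)) : covol b ≠ 0 := by
  rw [covol, Complex.ofReal_ne_zero, ENNReal.toReal_ne_zero]
  exact ⟨ZSpan.measure_fundamentalDomain_ne_zero b,
    (ZSpan.fundamentalDomain_isBounded b).measure_lt_top.ne⟩

/-- The normalized Fourier coefficient of a smooth form on the torus. -/
def fourierCoef (b : Basis (Fin n) ℝ (𝔼 n)) (p : ℕ) (k : Fin n → ℤ) :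
    smoothForms (latticeOf b) p →ₗ[ℂ] AltForm n p where
  toFun θ := (covol b)⁻¹ • fourierInt b (freq b k) (pullback _ θ.1)
  map_add' θ η := by
    have h := integral_add
      (integrableOn_planeWave_smul b (-freq b k) (contDiff_pullback θ).continuous)
      (integrableOn_planeWave_smul b (-freq b k) (contDiff_pullback η).continuous)
    have h' : fourierInt b (freq b k) (pullback _ (θ + η).1) =
        fourierInt b (freq b k) (pullback _ θ.1) + fourierInt b (freq b k) (pullback _ η.1) := by
      refine Eq.trans ?_ h
      refine integral_congr_ae (Filter.Eventually.of_forall fun x => ?_)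
      ext w
      exact mul_add (planeWave (-freq b k) x) (pullback _ θ.1 x w) (pullback _ η.1 x w)
    rw [h']
    ext w
    exact mul_add (covol b)⁻¹ _ _
  map_smul' c θ := by
    rw [RingHom.id_apply, smul_comm]
    congr 1
    unfold fourierInt
    rw [← integral_smul]
    simp only [smul_comm c]
    rfl

theorem fourierCoef_extD (b : Basis (Fin n) ℝ (𝔼 n)) (p : ℕ) (k : Fin n → ℤ)
    (θ : smoothForms (latticeOf b) p) :
    fourierCoef b (p + 1) k (extD _ p θ) =
      (2 * Real.pi * Complex.I : ℂ) • wedgeCovector p (freq b k) (fourierCoef b p k θ) := by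
  have h := fourierInt_extDeriv b k (contDiff_pullback θ)
    (fun l hl x => pullback_add_mem _ θ.1 hl x)
  change (covol b)⁻¹ • fourierInt b (freq b k) (extDeriv (pullback _ θ.1)) =
    (2 * Real.pi * Complex.I : ℂ) • wedgeCovector p (freq b k)
      ((covol b)⁻¹ • fourierInt b (freq b k) (pullback _ θ.1))
  rw [h, map_smul, smul_comm]

theorem fourierCoef_codiff (b : Basis (Fin n) ℝ (𝔼 n)) (p : ℕ) (k : Fin n → ℤ)
    (θ : smoothForms (latticeOf b) (p + 1)) :
    fourierCoef b p k (codiff _ p θ) =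
      -(2 * Real.pi * Complex.I : ℂ) •
        contractVector p (freq b k) (fourierCoef b (p + 1) k θ) := by
  have h := fourierInt_euclCodiff b k (contDiff_pullback θ)
    (fun l hl x => pullback_add_mem _ θ.1 hl x)
  change (covol b)⁻¹ • fourierInt b (freq b k) (euclCodiff p (pullback _ θ.1)) =
    -(2 * Real.pi * Complex.I : ℂ) • contractVector p (freq b k)
      ((covol b)⁻¹ • fourierInt b (freq b k) (pullback _ θ.1))
  rw [h, map_smul, smul_comm]

/-- On Fourier coefficients the operator `F_{αβ}` acts by its symbol. -/
theorem fourierCoef_hodgeOp (b : Basis (Fin n) ℝ (𝔼 n)) (α β : ℝ) (p : ℕ) (k : Fin n → ℤ)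
    (θ : smoothForms (latticeOf b) (p + 1)) :
    fourierCoef b (p + 1) k (hodgeOp _ α β (p + 1) θ) =
      hodgeSymbol α β p (freq b k) (fourierCoef b (p + 1) k θ) := by
  have hI : (2 * Real.pi * Complex.I : ℂ) * -(2 * Real.pi * Complex.I) = 4 * Real.pi ^ 2 := by
    linear_combination (-4 * (Real.pi : ℂ) ^ 2) * Complex.I_sq
  change fourierCoef b (p + 1) k ((α : ℂ) • extD _ p (codiff _ p θ) +
    (β : ℂ) • codiff _ (p + 1) (extD _ (p + 1) θ)) =
    (α * (4 * Real.pi ^ 2) : ℂ) • wedgeCovector p (freq b k)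
      (contractVector p (freq b k) (fourierCoef b (p + 1) k θ)) +
    (β * (4 * Real.pi ^ 2) : ℂ) • contractVector (p + 1) (freq b k)
      (wedgeCovector (p + 1) (freq b k) (fourierCoef b (p + 1) k θ))
  rw [map_add, map_smul, map_smul, fourierCoef_extD, fourierCoef_codiff, fourierCoef_codiff,
    fourierCoef_extD, map_smul, map_smul]
  simp only [smul_smul]
  rw [← hI]
  congr 2
  ring

/-- The form `x ↦ e^{2πi ⟪ξ, x⟫} v` on the torus. -/
def waveForm (b : Basis (Fin n) ℝ (𝔼 n)) (p : ℕ) (k : Fin n → ℤ) :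
    AltForm n p →ₗ[ℂ] smoothForms (latticeOf b) p where
  toFun v := ⟨descend _ (fun x => planeWave (freq b k) x • v)
      (fun l hl x => by rw [planeWave_periodic b k l hl]),
    (contDiff_planeWave (freq b k)).smul contDiff_const⟩
  map_add' v w := by
    apply Subtype.ext
    apply pullback_injective
    funext x
    exact smul_add (planeWave (freq b k) x) v w
  map_smul' c v := by
    apply Subtype.ext
    apply pullback_injective
    funext x
    exact smul_comm (planeWave (freq b k) x) c v

theorem fourierCoef_waveForm (b : Basis (Fin n) ℝ (𝔼 n)) (p : ℕ) (l k : Fin n → ℤ)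
    (v : AltForm n p) : fourierCoef b p l (waveForm b p k v) = if l = k then v else 0 := by
  have h : fourierCoef b p l (waveForm b p k v) = (covol b)⁻¹ •
      ((∫ x in ZSpan.fundamentalDomain b, planeWave (freq b (k - l)) x) • v) := by
    ext w
    refine congrArg (fun z => (covol b)⁻¹ * z) ?_
    refine (fourierInt_apply b _ (contDiff_pullback _).continuous w).trans ?_
    refine Eq.trans ?_ (integral_mul_const (v w) _)
    refine integral_congr_ae (Filter.Eventually.of_forall fun x => ?_)
    change planeWave (-freq b l) x * (planeWave (freq b k) x * v w) =
      planeWave (freq b (k - l)) x * v w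
    rw [freq_sub, sub_eq_add_neg, add_comm, planeWave_add, mul_assoc]
  rw [h]
  split_ifs with hlk
  · have h1 : ∫ x in ZSpan.fundamentalDomain b, planeWave (freq b (k - l)) x = covol b := by
      simp [hlk, freq_zero, planeWave_zero, covol, Measure.real]
    rw [h1, smul_smul, inv_mul_cancel₀ (covol_ne_zero b), one_smul]
  · rw [setIntegral_planeWave b (sub_ne_zero.2 (Ne.symm hlk)), zero_smul ℂ v]
    ext w
    exact mul_zero _

/-- A smooth form all of whose Fourier coefficients vanish is zero. -/
theorem eq_zero_of_fourierCoef (b : Basis (Fin n) ℝ (𝔼 n)) {p : ℕ}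
    {θ : smoothForms (latticeOf b) p} (h : ∀ k, fourierCoef b p k θ = 0) : θ = 0 := by
  apply Subtype.ext
  apply pullback_injective
  funext x
  ext w
  have hc := (contDiff_pullback θ).continuous
  refine congrFun (eq_zero_of_fourier_coefficients b (f := fun x => pullback _ θ.1 x w)
    ((ContinuousAlternatingMap.apply ℝ (𝔼 n) ℂ w).continuous.comp hc)
    (fun l hl x => by rw [pullback_add_mem _ θ.1 hl]) fun k => ?_) x
  -- The index is `-k` because the coefficient integrates against the wave of the negated frequency.
  have h1 : (covol b)⁻¹ * fourierInt b (freq b (-k)) (pullback _ θ.1) w = 0 :=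
    DFunLike.congr_fun (h (-k)) w
  have h2 := fourierInt_apply b (freq b (-k)) hc w
  rw [(mul_eq_zero.1 h1).resolve_left (inv_ne_zero (covol_ne_zero b)), freq_neg, neg_neg] at h2
  exact h2.symm

/-! ### Counting eigenvalues by frequencies. -/

/-- Since coefficients determine a vector, being an eigenvector is a condition on each coefficient
separately. Only those in the finite set `K` can be nonzero, so finite sums of waves exhaust the
eigenspace and no convergence question arises. -/
theorem finrank_eigenspace_of_coefficients {ι V W : Type*} [DecidableEq ι] [AddCommGroup V]
    [Module ℂ V] [AddCommGroup W] [Module ℂ W] [Module.Finite ℂ W] {F : Module.End ℂ V}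
    {c : ι → V →ₗ[ℂ] W} {w : ι → W →ₗ[ℂ] V} {S : ι → Module.End ℂ W}
    (hcF : ∀ k θ, c k (F θ) = S k (c k θ)) (hcw : ∀ l k y, c l (w k y) = if l = k then y else 0)
    (hc : ∀ θ, (∀ k, c k θ = 0) → θ = 0) (μ : ℂ) (K : Finset ι)
    (hK : ∀ k ∉ K, LinearMap.ker (S k - μ • 1) = ⊥) :
    finrank ℂ (F.eigenspace μ) = ∑ k ∈ K, finrank ℂ (LinearMap.ker (S k - μ • 1)) := by
  have hmem : ∀ θ, θ ∈ F.eigenspace μ ↔ ∀ k, c k θ ∈ LinearMap.ker (S k - μ • 1) := by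
    intro θ
    rw [Module.End.mem_eigenspace_iff]
    have : ∀ k, c k (F θ - μ • θ) = (S k - μ • 1) (c k θ) := fun k => by
      rw [map_sub, hcF, map_smul]
      rfl
    simp only [LinearMap.mem_ker, ← this]
    rw [← sub_eq_zero]
    exact ⟨fun h k => by rw [h, map_zero], hc _⟩
  let Φ : F.eigenspace μ →ₗ[ℂ] ∀ k : K, LinearMap.ker (S k - μ • 1) :=
    LinearMap.pi fun k => ((c k).comp (Submodule.subtype _)).codRestrict _
      fun θ => (hmem θ).1 θ.2 k
  have hΦ : Function.Bijective Φ := by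
    constructor
    · rw [← LinearMap.ker_eq_bot, LinearMap.ker_eq_bot']
      intro θ hθ
      refine Subtype.ext (hc _ fun k => ?_)
      by_cases hk : k ∈ K
      · exact congrArg Subtype.val (congrFun hθ ⟨k, hk⟩)
      · have := (hmem θ).1 θ.2 k
        rwa [hK k hk, Submodule.mem_bot] at this
    · intro y
      have hsum : ∀ l, c l (∑ k : K, w k (y k)) = if h : l ∈ K then (y ⟨l, h⟩ : W) else 0 := by
        intro l
        rw [map_sum]
        simp only [hcw]
        split_ifs with h
        · rw [Finset.sum_eq_single ⟨l, h⟩]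
          · simp
          · intro k _ hk
            rw [if_neg]
            rintro rfl
            exact hk rfl
          · simp
        · refine Finset.sum_eq_zero fun k _ => if_neg ?_
          rintro rfl
          exact h k.2
      refine ⟨⟨∑ k : K, w k (y k), (hmem _).2 fun l => ?_⟩, ?_⟩
      · rw [hsum]
        split_ifs with h
        · exact (y ⟨l, h⟩).2
        · exact zero_mem _
      · funext k
        apply Subtype.ext
        change c k (∑ k : K, w k (y k)) = y k
        rw [hsum, dif_pos k.2]
  rw [(LinearEquiv.ofBijective Φ hΦ).finrank_eq, Module.finrank_pi_fintype]
  exact Finset.sum_coe_sort K fun k => finrank ℂ (LinearMap.ker (S k - μ • 1))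

/-- The multiplicity of `s` in the spectrum of the Laplace operator on functions on the torus of
`b`. -/
def laplaceMult (b : Basis (Fin n) ℝ (𝔼 n)) (s : ℝ) : ℕ :=
  {k : Fin n → ℤ | 4 * Real.pi ^ 2 * ‖freq b k‖ ^ 2 = s}.ncard

theorem finite_laplace (b : Basis (Fin n) ℝ (𝔼 n)) (s : ℝ) :
    {k : Fin n → ℤ | 4 * Real.pi ^ 2 * ‖freq b k‖ ^ 2 ≤ s}.Finite := by
  refine (finite_freq_norm_le b (1 + s)).subset fun k hk => ?_
  rw [Set.mem_ofPred_eq] at hk ⊢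
  -- The radius `1 + s` is crude: it follows from `2‖ξ‖ ≤ 1 + ‖ξ‖²` and `‖ξ‖² ≤ s`.
  have h1 : 1 ≤ Real.pi ^ 2 := by nlinarith [Real.pi_gt_three]
  nlinarith [norm_nonneg (freq b k), mul_le_mul_of_nonneg_right h1 (sq_nonneg ‖freq b k‖),
    sq_nonneg (‖freq b k‖ - 1)]

theorem finite_dilated (b : Basis (Fin n) ℝ (𝔼 n)) {α : ℝ} (hα : 0 < α) (μ : ℂ) :
    {k : Fin n → ℤ | (α * (4 * Real.pi ^ 2) * ‖freq b k‖ ^ 2 : ℂ) = μ}.Finite := by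
  refine (finite_laplace b (μ.re / α)).subset fun k hk => ?_
  rw [Set.mem_ofPred_eq] at hk ⊢
  rw [le_div_iff₀ hα, ← hk]
  apply le_of_eq
  rw [show (α * (4 * Real.pi ^ 2) * ‖freq b k‖ ^ 2 : ℂ) =
    ((α * (4 * Real.pi ^ 2) * ‖freq b k‖ ^ 2 : ℝ) : ℂ) by push_cast; rfl, Complex.ofReal_re]
  ring

/-- The number of frequencies at which the Laplace operator, dilated by `α`, has eigenvalue `μ`. -/
def dilatedMult (b : Basis (Fin n) ℝ (𝔼 n)) (α : ℝ) (μ : ℂ) : ℕ :=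
  {k : Fin n → ℤ | (α * (4 * Real.pi ^ 2) * ‖freq b k‖ ^ 2 : ℂ) = μ}.ncard

/-- Each frequency contributes the rank of `P` to the eigenvalue given by `α` and its nullity to the
one given by `β`. Dimension and degree are `n + 1` and `p + 1`, so the weights are the `C(n-1, p-1)`
and `C(n-1, p)` of the usual indexing. -/
theorem spec_latticeOf (b : Basis (Fin (n + 1)) ℝ (𝔼 (n + 1))) {α β : ℝ} (hα : 0 < α)
    (hβ : 0 < β) (p : ℕ) (μ : ℂ) :
    spec (latticeOf b) α β (p + 1) μ =
      n.choose p * dilatedMult b α μ + n.choose (p + 1) * dilatedMult b β μ := by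
  classical
  have hA := finite_dilated b hα μ
  have hB := finite_dilated b hβ μ
  have count : ∀ {A : Set (Fin (n + 1) → ℤ)} (hA : A.Finite) (K : Finset (Fin (n + 1) → ℤ))
      (_ : hA.toFinset ⊆ K) (m : ℕ), ∑ k ∈ K, (if k ∈ A then m else 0) = m * A.ncard := by
    intro A hA K hK m
    rw [← Finset.sum_filter, Finset.sum_const, smul_eq_mul, mul_comm,
      Set.ncard_eq_toFinset_card A hA]
    congr 2
    ext k
    rw [Finset.mem_filter, Set.Finite.mem_toFinset]
    exact ⟨And.right, fun h => ⟨hK (hA.mem_toFinset.2 h), h⟩⟩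
  have key := finrank_eigenspace_of_coefficients (V := smoothForms (latticeOf b) (p + 1))
    (fourierCoef_hodgeOp b α β p)
    (fourierCoef_waveForm b (p + 1)) (fun θ => eq_zero_of_fourierCoef b) μ
    (hA.toFinset ∪ hB.toFinset) (fun k hk => by
      rw [Finset.mem_union, not_or, hA.mem_toFinset, hB.mem_toFinset, Set.mem_ofPred_eq,
        Set.mem_ofPred_eq] at hk
      rw [← Submodule.finrank_eq_zero (R := ℂ), finrank_eigenspace_hodgeSymbol, if_neg hk.1,
        if_neg hk.2])
  rw [spec, key]
  simp only [finrank_eigenspace_hodgeSymbol]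
  rw [Finset.sum_add_distrib, dilatedMult, dilatedMult, ← count hA _ Finset.subset_union_left,
    ← count hB _ Finset.subset_union_right]
  rfl

theorem dilatedMult_ofReal (b : Basis (Fin n) ℝ (𝔼 n)) {α : ℝ} (hα : 0 < α) (s : ℝ) :
    dilatedMult b α s = laplaceMult b (s / α) := by
  rw [dilatedMult, laplaceMult]
  congr 1
  ext k
  rw [Set.mem_ofPred_eq, Set.mem_ofPred_eq, eq_div_iff hα.ne', ← Complex.ofReal_inj]
  push_cast
  rw [mul_comm (_ * _) (α : ℂ), mul_assoc, mul_assoc]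

/-! ### Rescaling the lattice, and the least positive eigenvalue. -/

/-- The basis `c b` of `ℝⁿ`. -/
def scaledBasis (b : Basis (Fin n) ℝ (𝔼 n)) {c : ℝ} (hc : c ≠ 0) : Basis (Fin n) ℝ (𝔼 n) :=
  b.unitsSMul fun _ => Units.mk0 c hc

theorem scaledBasis_apply (b : Basis (Fin n) ℝ (𝔼 n)) {c : ℝ} (hc : c ≠ 0) (i : Fin n) :
    scaledBasis b hc i = c • b i := by
  rw [scaledBasis, Basis.unitsSMul_apply]
  rfl

theorem latticeOf_scaledBasis (b : Basis (Fin n) ℝ (𝔼 n)) {c : ℝ} (hc : c ≠ 0) :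
    latticeOf (scaledBasis b hc) = c • latticeOf b := by
  rw [latticeOf, latticeOf, Submodule.smul_span]
  congr 1
  ext x
  simp [Set.mem_smul_set, scaledBasis_apply]

theorem freq_scaledBasis (b : Basis (Fin n) ℝ (𝔼 n)) {c : ℝ} (hc : c ≠ 0) (k : Fin n → ℤ) :
    freq (scaledBasis b hc) k = c⁻¹ • freq b k := by
  refine InnerProductSpace.ext_inner_right_basis (scaledBasis b hc) fun i => ?_
  rw [inner_freq_basis, scaledBasis_apply, real_inner_smul_left, real_inner_smul_right,
    inner_freq_basis, inv_mul_cancel_left₀ hc]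

theorem dilatedMult_scaledBasis (b : Basis (Fin n) ℝ (𝔼 n)) {c : ℝ} (hc : c ≠ 0) (α : ℝ)
    (μ : ℂ) : dilatedMult (scaledBasis b hc) α μ = dilatedMult b (α / c ^ 2) μ := by
  rw [dilatedMult, dilatedMult]
  congr 1
  ext k
  have hnorm : ‖freq (scaledBasis b hc) k‖ ^ 2 = (c ^ 2)⁻¹ * ‖freq b k‖ ^ 2 := by
    rw [freq_scaledBasis, norm_smul, mul_pow, norm_inv, inv_pow, Real.norm_eq_abs, sq_abs]
  rw [Set.mem_ofPred_eq, Set.mem_ofPred_eq, ← Complex.ofReal_pow ‖_‖, hnorm]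
  push_cast
  rw [show (α : ℂ) / c ^ 2 * (4 * Real.pi ^ 2) * ‖freq b k‖ ^ 2 =
    α * (4 * Real.pi ^ 2) * (((c : ℂ) ^ 2)⁻¹ * ‖freq b k‖ ^ 2) by ring]

/-- The Laplace operator on functions on the torus has a least positive eigenvalue. -/
theorem exists_least_pos_laplaceMult (b : Basis (Fin (n + 1)) ℝ (𝔼 (n + 1))) :
    ∃ m, 0 < m ∧ laplaceMult b m ≠ 0 ∧ ∀ s, 0 < s → s < m → laplaceMult b s = 0 := by
  set q : (Fin (n + 1) → ℤ) → ℝ := fun k => 4 * Real.pi ^ 2 * ‖freq b k‖ ^ 2 with hq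
  have hfin : ∀ s, {k | q k = s}.Finite := fun s =>
    (finite_laplace b s).subset fun k hk => le_of_eq hk
  have hone : (1 : Fin (n + 1) → ℤ) ≠ 0 := one_ne_zero
  -- The all-ones vector is just some nonzero frequency; bounding by its value makes the set to be
  -- minimised over finite and nonempty.
  obtain ⟨k, ⟨hk0, hk1⟩, hmin⟩ := Set.exists_min_image {k | k ≠ 0 ∧ q k ≤ q 1} q
    ((finite_laplace b (q 1)).subset fun k hk => hk.2) ⟨1, hone, le_rfl⟩
  have hfk : freq b k ≠ 0 := by
    rw [← freq_zero b]
    exact (freq_injective b).ne hk0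
  have hpos : 0 < ‖freq b k‖ := norm_pos_iff.2 hfk
  refine ⟨q k, by positivity, (Set.ncard_pos (hfin _)).2 ⟨k, rfl⟩ |>.ne', fun s hs hsk => ?_⟩
  rw [laplaceMult, Set.ncard_eq_zero (hfin s), Set.eq_empty_iff_forall_notMem]
  intro l (hl : q l = s)
  have hl0 : l ≠ 0 := by
    rintro rfl
    rw [hq] at hl
    simp only [freq_zero, norm_zero] at hl
    norm_num at hl
    exact hs.ne hl
  have := hmin l ⟨hl0, by linarith⟩
  linarith

theorem exists_basis_latticeOf_eq (Λ : Submodule ℤ (𝔼 n)) [DiscreteTopology Λ] [IsZLattice ℝ Λ] :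
    ∃ b : Basis (Fin n) ℝ (𝔼 n), latticeOf b = Λ := by
  have : Module.Finite ℤ Λ := ZLattice.module_finite ℝ Λ
  have : Module.Free ℤ Λ := ZLattice.module_free ℝ Λ
  have h : finrank ℤ Λ = n := by rw [ZLattice.rank ℝ Λ, finrank_euclideanSpace_fin]
  exact ⟨(finBasisOfFinrankEq ℤ Λ h).ofZLatticeBasis ℝ Λ, Basis.ofZLatticeBasis_span ℝ Λ _⟩

theorem isospectral_iff (b : Basis (Fin (n + 1)) ℝ (𝔼 (n + 1))) {α β α' β' c : ℝ} (hα : 0 < α)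
    (hβ : 0 < β) (hα' : 0 < α') (hβ' : 0 < β') (hc : c ≠ 0) (p : ℕ) :
    Isospectral (p + 1) (latticeOf b) α β (c • latticeOf b) α' β' ↔
      ∀ μ, n.choose p * dilatedMult b α μ + n.choose (p + 1) * dilatedMult b β μ =
        n.choose p * dilatedMult b (α' / c ^ 2) μ +
          n.choose (p + 1) * dilatedMult b (β' / c ^ 2) μ := by
  rw [Isospectral, funext_iff, ← latticeOf_scaledBasis b hc]
  simp only [spec_latticeOf b hα hβ, spec_latticeOf (scaledBasis b hc) hα' hβ',
    dilatedMult_scaledBasis]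

end FlatTorus

end

/-! ### The three cases of the theorem. -/

theorem mainTheorem8 {n p : ℕ} (hp : 1 ≤ p) (hpn : p ≤ n)
    (Λ : Submodule ℤ (EuclideanSpace ℝ (Fin n))) [DiscreteTopology Λ] [IsZLattice ℝ Λ]
    {α β α' β' : ℝ} (hα : 0 < α) (hβ : 0 < β) (hα' : 0 < α') (hβ' : 0 < β')
    {c : ℝ} (hc : c ≠ 0) :
    (p < n → n ≠ 2 * p →
      (FlatTorus.Isospectral p Λ α β (c • Λ) α' β' ↔ (α', β') = (c ^ 2 * α, c ^ 2 * β))) ∧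
    (n = 2 * p →
      (FlatTorus.Isospectral p Λ α β (c • Λ) α' β' ↔
        ({α', β'} : Set ℝ) = {c ^ 2 * α, c ^ 2 * β})) ∧
    (p = n →
      (FlatTorus.Isospectral p Λ α β (c • Λ) α' β' ↔ α' = c ^ 2 * α)) := by
  obtain ⟨q, rfl⟩ : ∃ q, p = q + 1 := ⟨p - 1, by omega⟩
  obtain ⟨d, rfl⟩ : ∃ d, n = d + 1 := ⟨n - 1, by omega⟩
  obtain ⟨b, rfl⟩ := FlatTorus.exists_basis_latticeOf_eq Λ
  obtain ⟨m, hm, hMm, hM⟩ := FlatTorus.exists_least_pos_laplaceMult b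
  have hc2 : 0 < c ^ 2 := by positivity
  have scale : ∀ x y : ℝ, x = c ^ 2 * y ↔ y = x / c ^ 2 := fun x y => by
    rw [eq_div_iff hc2.ne', mul_comm, eq_comm]
  have hα₁ : 0 < α' / c ^ 2 := by positivity
  have hβ₁ : 0 < β' / c ^ 2 := by positivity
  have hq : 0 < d.choose q := Nat.choose_pos (by omega)
  rw [FlatTorus.isospectral_iff b hα hβ hα' hβ' hc q]
  have real : (∀ μ, d.choose q * FlatTorus.dilatedMult b α μ +
        d.choose (q + 1) * FlatTorus.dilatedMult b β μ =
      d.choose q * FlatTorus.dilatedMult b (α' / c ^ 2) μ +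
        d.choose (q + 1) * FlatTorus.dilatedMult b (β' / c ^ 2) μ) →
      ∀ s, d.choose q * FlatTorus.laplaceMult b (s / α) +
        d.choose (q + 1) * FlatTorus.laplaceMult b (s / β) =
      d.choose q * FlatTorus.laplaceMult b (s / (α' / c ^ 2)) +
        d.choose (q + 1) * FlatTorus.laplaceMult b (s / (β' / c ^ 2)) := by
    intro h s
    have := h s
    rwa [FlatTorus.dilatedMult_ofReal b hα, FlatTorus.dilatedMult_ofReal b hβ,
      FlatTorus.dilatedMult_ofReal b hα₁, FlatTorus.dilatedMult_ofReal b hβ₁] at this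
  -- With `d = n - 1` and `q = p - 1`, this compares the two weights: for `p < n` they agree exactly
  -- when `p = n - p`.
  have hchoose : d.choose (q + 1) * (q + 1) = d.choose q * (d - q) := Nat.choose_succ_right_eq d q
  refine ⟨fun hlt hne => ?_, fun heq => ?_, fun heq => ?_⟩
  · have hq1 : 0 < d.choose (q + 1) := Nat.choose_pos (by omega)
    rw [Prod.mk.injEq, scale, scale]
    constructor
    · intro h
      refine (FlatTorus.dilations_eq_or_swap hm hMm hM hq hq1 hα hβ hα₁ hβ₁ (real h)).resolve_right
        fun h' => ?_
      -- A swap would require equal weights, hence `n = 2p`.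
      rw [← h'.1] at hchoose
      have := Nat.eq_of_mul_eq_mul_left hq hchoose
      omega
    · rintro ⟨h1, h2⟩ μ
      rw [← h1, ← h2]
  · have hq1 : 0 < d.choose (q + 1) := Nat.choose_pos (by omega)
    rw [Set.pair_eq_pair_iff, scale, scale, scale, scale]
    constructor
    · intro h
      rcases FlatTorus.dilations_eq_or_swap hm hMm hM hq hq1 hα hβ hα₁ hβ₁ (real h) with h' | h'
      · exact Or.inl h'
      · exact Or.inr ⟨h'.2.2, h'.2.1⟩
    · rintro (⟨h1, h2⟩ | ⟨h1, h2⟩) μ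
      · rw [← h1, ← h2]
      · have hqq : d.choose (q + 1) = d.choose q := by
          rw [show d - q = q + 1 by omega] at hchoose
          exact Nat.eq_of_mul_eq_mul_right (by omega) hchoose
        rw [← h1, ← h2, hqq, add_comm]
  -- In top degree the weight of the `β` term vanishes, and one dilation remains.
  · have hq1 : d.choose (q + 1) = 0 := Nat.choose_eq_zero_of_lt (by omega)
    rw [scale]
    constructor
    · intro h
      refine FlatTorus.dilation_eq hm hMm hM hα hα₁ fun s => ?_
      have := real h s
      rw [hq1, zero_mul, zero_mul, add_zero, add_zero] at this
      exact Nat.eq_of_mul_eq_mul_left hq this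
    · intro h μ
      rw [← h, hq1, zero_mul, zero_mul]
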